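/- **Local weighted Poincaré inequality.** Let $N\ge 2$, let $\Omega\subset\mathbb R^N$ be a bounded domain of class $C^2$ containing the origin, and put $d(y)=\operatorname{dist}(y,\partial\Omega)$. Fix a local representation of $\partial\Omega$: finitely many Cartesian coordinate systems $y\mapsto(y_i',y_{iN})\in\mathbb R^{N-1}\times\mathbb R$, $i=1,\dots,m$, a closed cube $\Delta=\{y'\in\mathbb R^{N-1}:|y'_j|\le\delta,\ 1\le j\le N-1\}$ with $\delta>0$, Lipschitz functions $a_i:\Delta\to\mathbb R$ and a number $\beta_0\in(0,1)$ such that, with $B_i=\{y: y_i'\in\Delta,\ a_i(y_i')-\beta_0<y_{iN}<a_i(y_i')+\beta_0\}$, $$B_i\cap\Omega=\{y\in B_i: y_{iN}<a_i(y_i')\},\qquad B_i\cap\partial\Omega=\Gamma_i:=\{y: y_i'\in\Delta,\ y_{iN}=a_i(y_i')\},$$ and $\partial\Omega=\bigcup_i\Gamma_i$. Fix also $\gamma\in(1,2)$. For $x\in\Omega$ and $r>0$ let $\mathcal B(x,r)$ be the Euclidean ball $B(x,r)$ if $d(x)\ge\gamma r$, and $$\mathcal B(x,r)=\{y:\ y_i'\in\Delta,\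 |y_i'-x_i'|\le r,\ a_i(y_i')-r-d(x)<y_{iN}<a_i(y_i')+r-d(x)\}$$ if $d(x)<\gamma r$, where $i$ is an index such that $\Gamma_i$ contains a point $\bar x\in\partial\Omega$ with $|\bar x-x|=d(x)$ (every such choice of $\bar x$ and $i$ is allowed). Let $\alpha>0$ and $\lambda\in(-N,0]$. Then there exist constants $C_P>0$ and $\beta\in(0,\beta_0]$ such that for all $x\in\Omega$, all $0<r<\beta$, every such set $\mathcal B(x,r)$ and every $f\in C^1(\overline{\mathcal B(x,r)\cap\Omega})$, all the integrals below are finite and $$\inf_{\xi\in\mathbb R}\int_{\mathcal B(x,r)\cap\Omega}|y|^\lambda d^\alpha(y)\,|f(y)-\xi|^2\,dy\ \le\ C_P\,r^2\int_{\mathcal B(x,r)\cap\Omega}|y|^\lambda d^\alpha(y)\,|\nabla f(y)|^2\,dy .$$ Here $f\in C^1(\overline U)$ means that $f$ is continuous on $\overline U$, differentiable in the interior of $U$, and that $\nabla f$ extends continuously from the interior of $U$ to $\overline U$. -/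

import Mathlib

open MeasureTheory Topology

/-- `N`-dimensional Euclidean space. -/
abbrev Eucl (N : ℕ) : Type := EuclideanSpace ℝ (Fin N)

/-- A Cartesian coordinate system `y ↦ (y', y_N)` of `N`-dimensional space (a rigid motion). -/
abbrev CoordSystem (N : ℕ) : Type :=
  Eucl N ≃ᵃⁱ[ℝ] WithLp 2 (Eucl (N - 1) × ℝ)

/-- Distance to the boundary of `Ω`. -/
noncomputable def bdist {N : ℕ} (Ω : Set (Eucl N)) (y : Eucl N) : ℝ :=
  Metric.infDist y (frontier Ω)

/-- A bounded domain (open connected set) of class `C²`: near each of its boundary points it is,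
in suitable Cartesian coordinates, the region below the graph of a `C²` function. -/
structure IsC2BoundedDomain {N : ℕ} (Ω : Set (Eucl N)) : Prop where
  isOpen : IsOpen Ω
  isConnected : IsConnected Ω
  isBounded : Bornology.IsBounded Ω
  boundary_C2 : ∀ x ∈ frontier Ω, ∃ (e : CoordSystem N) (φ : Eucl (N - 1) → ℝ),
    ContDiff ℝ 2 φ ∧ ∀ᶠ y in 𝓝 x, (y ∈ Ω ↔ (e y).snd < φ (e y).fst)

/-- The closed cube of half-side `δ` centred at the origin. -/
def cube {n : ℕ} (δ : ℝ) : Set (Eucl n) := {y | ∀ j, |y j| ≤ δ}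

/-- A local representation of the boundary of `Ω` by Lipschitz graphs: finitely many coordinate
systems, and functions `a i` on the closed cube `Δ` (only the values there are relevant), whose
graphs cover the boundary, `Ω` lying locally below the graphs. -/
structure LocalRep {N : ℕ} (Ω : Set (Eucl N)) where
  /-- number of charts -/
  m : ℕ
  /-- coordinate systems `y ↦ (y_i', y_{iN})` -/
  coord : Fin m → CoordSystem N
  /-- half-side of the cubes -/
  δ : ℝ
  /-- the functions whose graphs represent the boundary -/
  a : Fin m → Eucl (N - 1) → ℝ
  /-- common Lipschitz constant -/
  A : ℝ
  /-- half-height of the sets `B_i` -/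
  β : ℝ
  δ_pos : 0 < δ
  A_pos : 0 < A
  β_pos : 0 < β
  β_lt_one : β < 1
  lipschitz : ∀ i, ∀ y ∈ cube δ, ∀ z ∈ cube δ, |a i y - a i z| ≤ A * ‖y - z‖
  /-- `B_i ∩ Ω` is the part of `B_i` strictly below the graph. -/
  inter_domain : ∀ i (y : Eucl N), (coord i y).fst ∈ cube δ →
    a i (coord i y).fst - β < (coord i y).snd → (coord i y).snd < a i (coord i y).fst + β →
    (y ∈ Ω ↔ (coord i y).snd < a i (coord i y).fst)
  /-- `B_i ∩ ∂Ω` is the graph. -/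
  inter_frontier : ∀ i (y : Eucl N), (coord i y).fst ∈ cube δ →
    a i (coord i y).fst - β < (coord i y).snd → (coord i y).snd < a i (coord i y).fst + β →
    (y ∈ frontier Ω ↔ (coord i y).snd = a i (coord i y).fst)
  /-- The graphs cover the boundary. -/
  cover : ∀ x ∈ frontier Ω, ∃ i,
    (coord i x).fst ∈ cube δ ∧ (coord i x).snd = a i (coord i x).fst

namespace LocalRep

variable {N : ℕ} {Ω : Set (Eucl N)}

/-- The graph `Γ_i` of `a i` over the cube: the portion of the boundary seen by chart `i`. -/
def Γ (R : LocalRep Ω) (i : Fin R.m) : Set (Eucl N) :=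
  {y | (R.coord i y).fst ∈ cube R.δ ∧ (R.coord i y).snd = R.a i (R.coord i y).fst}

/-- The deformed cube with centre `x` and radius `r` in chart `i`:
`|y' - x'| ≤ r` and `a_i(y') - r - d(x) < y_N < a_i(y') + r - d(x)`, where `y'` runs over the
cube on which `a_i` is defined. -/
def deformedCube (R : LocalRep Ω) (i : Fin R.m) (x : Eucl N) (r : ℝ) : Set (Eucl N) :=
  {y | (R.coord i y).fst ∈ cube R.δ ∧
    ‖(R.coord i y).fst - (R.coord i x).fst‖ ≤ r ∧
    R.a i (R.coord i y).fst - r - bdist Ω x < (R.coord i y).snd ∧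
    (R.coord i y).snd < R.a i (R.coord i y).fst + r - bdist Ω x}

/-- `S` is a boundary-adapted "ball" `𝓑(x,r)`: the Euclidean ball if `d(x) ≥ γ r`, and otherwise
a deformed cube in a chart `i` that contains a nearest boundary point `x̄` of `x`
(if several nearest points or charts qualify, each of them is admitted). -/
def IsAdaptedBall (R : LocalRep Ω) (γ : ℝ) (x : Eucl N) (r : ℝ) (S : Set (Eucl N)) : Prop :=
  (γ * r ≤ bdist Ω x ∧ S = Metric.ball x r) ∨
  (bdist Ω x < γ * r ∧ ∃ (i : Fin R.m) (xbar : Eucl N), xbar ∈ frontier Ω ∧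
    dist xbar x = bdist Ω x ∧ xbar ∈ R.Γ i ∧ S = R.deformedCube i x r)

end LocalRep

/-- `f ∈ C¹(closure S)`: `f` is continuous on the closure of `S`, differentiable in the interior
of `S`, and its gradient there extends continuously to the closure of `S`. -/
def C1OnClosure {N : ℕ} (S : Set (Eucl N)) (f : Eucl N → ℝ) : Prop :=
  ContinuousOn f (closure S) ∧
  ∃ G : Eucl N → Eucl N, ContinuousOn G (closure S) ∧ ∀ y ∈ interior S, HasGradientAt f (G y) y

/-- The weight `|y|^lam d(y)^α`. -/
noncomputable def poincareWeight {N : ℕ} (Ω : Set (Eucl N)) (lam α : ℝ) (y : Eucl N) : ℝ :=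
  ‖y‖ ^ lam * bdist Ω y ^ α

/-! The oscillation of `f` is bounded along segments. If `|f x - f y|²` is at most the integral of
`g` over the segment from `x` to `y`, multiply by `w x * u y`, integrate over `x` and `y`, and use
the variables `z = x + s • (y - x)` and `v = y - x`. Everything reduces to bounding the integral
over `v` of `w (z - s • v) * u (z + (1 - s) • v)` by a multiple of `w z`, uniformly in `s`
(`exists_lintegral_sq_sub_le`). The auxiliary weight `u` is free, and the two kinds of adapted ball
use different choices.

Balls with `γ r ≤ d(x)`: since `γ > 1`, the distance `d` is comparable to a constant on the ball, so
the weight behaves like `|y|^lam`. For `-N < lam ≤ 0` this is an A₁ weight, and `u = 1` works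
(`poincare_ball`).

Deformed cubes: near the boundary `|y|` is bounded above and away from zero, and `d` is comparable
to the vertical distance `t = a_i(y') - y_N`, so the weight behaves like `t^α`. The coordinates
`(y', t)` preserve volume, have a Lipschitz inverse and make the set a convex product. On a segment
in `t > 0`, the value of `t` at the endpoint is at most twice its value anywhere on the second half,
so `u = w` works (`exists_lintegral_sq_sub_le_of_doubling`, `poincare_deformedCube`).

The bound `d ≥ c t` must hold up to the edges of the cube, where the nearest boundary point may lie
outside the chart. It is obtained from a C² defining function whose derivative is transversal to the
graph (`fderiv_vertical_pos`, `exists_le_bdist`). -/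

/-! ### Poincaré inequalities by integration along segments -/

open Set ENNReal in
/-- An abstract weighted Poincaré inequality on a set `D` in a vector space, obtained by integrating
a bound for `|f x - f y|²` along segments. -/
theorem exists_lintegral_sq_sub_le {E : Type*} [NormedAddCommGroup E] [NormedSpace ℝ E]
    [FiniteDimensional ℝ E] [MeasurableSpace E] [BorelSpace E] (μ : Measure E)
    [μ.IsAddHaarMeasure] {D : Set E} (hD : MeasurableSet D) (hconv : Convex ℝ D)
    {w u g : E → ℝ≥0∞} (hw : Measurable w) (hu : Measurable u) (hg : Measurable g)
    {f : E → ℝ} (hf : Measurable f)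
    (hfg : ∀ x ∈ D, ∀ y ∈ D,
      ENNReal.ofReal (|f x - f y| ^ 2) ≤ ∫⁻ s in Ioo (0 : ℝ) 1, g (x + s • (y - x)))
    {K : ℝ≥0∞}
    (hK : ∀ s ∈ Ioo (0 : ℝ) 1, ∀ᵐ z ∂μ, z ∈ D →
      ∫⁻ v, D.indicator w (z - s • v) * D.indicator u (z + (1 - s) • v) ∂μ ≤ K * w z)
    (hU0 : ∫⁻ y in D, u y ∂μ ≠ 0) (hU : ∫⁻ y in D, u y ∂μ ≠ ∞) :
    ∃ ξ : ℝ, ∫⁻ x in D, w x * ENNReal.ofReal (|f x - ξ| ^ 2) ∂μ ≤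
      K / (∫⁻ y in D, u y ∂μ) * ∫⁻ x in D, w x * g x ∂μ := by
  set U := ∫⁻ y in D, u y ∂μ with hUdef
  set W := D.indicator w with hW
  set V := D.indicator u with hV
  set g' := D.indicator g with hg'
  have mW : Measurable W := hw.indicator hD
  have mV : Measurable V := hu.indicator hD
  have mg : Measurable g' := hg.indicator hD
  let H : E → ℝ≥0∞ := fun y => ∫⁻ x, W x * ENNReal.ofReal (|f x - f y| ^ 2) ∂μ
  have mH : Measurable H := by
    apply Measurable.lintegral_prod_right'
      (f := fun p : E × E => W p.2 * ENNReal.ofReal (|f p.2 - f p.1| ^ 2))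
    fun_prop
  -- For fixed `s`, the change from `(x, y)` to `(z, v)` is a composition of translations in one
  -- variable at a time, so no Jacobian appears; `x = z - s • v` and `y = z + (1 - s) • v`.
  have hslice : ∀ s ∈ Ioo (0 : ℝ) 1,
      ∫⁻ y, ∫⁻ x, V y * W x * g' (x + s • (y - x)) ∂μ ∂μ ≤ K * ∫⁻ x in D, w x * g x ∂μ := by
    intro s hs
    calc ∫⁻ y, ∫⁻ x, V y * W x * g' (x + s • (y - x)) ∂μ ∂μ
        = ∫⁻ x, ∫⁻ y, V y * W x * g' (x + s • (y - x)) ∂μ ∂μ :=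
          lintegral_lintegral_swap (by fun_prop)
      _ = ∫⁻ x, ∫⁻ v, V (x + v) * W x * g' (x + s • v) ∂μ ∂μ := by
          congr 1 with x
          rw [← lintegral_add_left_eq_self _ x]
          simp
      _ = ∫⁻ v, ∫⁻ x, V (x + v) * W x * g' (x + s • v) ∂μ ∂μ :=
          lintegral_lintegral_swap (by fun_prop)
      _ = ∫⁻ v, ∫⁻ z, V (z + (1 - s) • v) * W (z - s • v) * g' z ∂μ ∂μ := by
          congr 1 with v
          rw [← lintegral_sub_right_eq_self _ (s • v)]
          congr 1 with z
          rw [sub_add_cancel, sub_smul, one_smul]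
          congr 3
          abel
      _ = ∫⁻ z, ∫⁻ v, V (z + (1 - s) • v) * W (z - s • v) * g' z ∂μ ∂μ :=
          lintegral_lintegral_swap (by fun_prop)
      _ ≤ ∫⁻ z, K * (D.indicator (fun z => w z * g z) z) ∂μ := by
          apply lintegral_mono_ae
          filter_upwards [hK s hs] with z hz
          rw [lintegral_mul_const _ (by fun_prop)]
          by_cases hzD : z ∈ D
          · simp only [hg', indicator_of_mem hzD]
            rw [← mul_assoc]
            gcongr
            refine le_trans (le_of_eq ?_) (hz hzD)
            congr 1 with v
            rw [mul_comm]
          · simp [hg', hzD]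
      _ = K * ∫⁻ x in D, w x * g x ∂μ := by
          rw [lintegral_const_mul _ (Measurable.indicator (by fun_prop) hD), lintegral_indicator hD]
  have hmain : ∫⁻ y, V y * H y ∂μ ≤ K * ∫⁻ x in D, w x * g x ∂μ := by
    calc ∫⁻ y, V y * H y ∂μ
        ≤ ∫⁻ y, ∫⁻ x, ∫⁻ s in Ioo (0 : ℝ) 1, V y * W x * g' (x + s • (y - x)) ∂volume ∂μ ∂μ := by
          apply lintegral_mono
          intro y
          simp only [H]
          rw [← lintegral_const_mul _ (by fun_prop)]
          apply lintegral_mono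
          intro x
          simp only
          rw [lintegral_const_mul _ (by fun_prop), mul_assoc]
          by_cases hy : y ∈ D
          · by_cases hx : x ∈ D
            · gcongr
              refine (hfg x hx y hy).trans (le_of_eq ?_)
              apply setLIntegral_congr_fun measurableSet_Ioo
              intro s hs
              simp only [hg']
              rw [indicator_of_mem]
              exact hconv.add_smul_sub_mem hx hy ⟨hs.1.le, hs.2.le⟩
            · simp [hW, hx]
          · simp [hV, hy]
      _ = ∫⁻ y, ∫⁻ s in Ioo (0 : ℝ) 1, ∫⁻ x, V y * W x * g' (x + s • (y - x)) ∂μ ∂volume ∂μ := by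
          congr 1 with y
          exact lintegral_lintegral_swap (by fun_prop)
      _ = ∫⁻ s in Ioo (0 : ℝ) 1, ∫⁻ y, ∫⁻ x, V y * W x * g' (x + s • (y - x)) ∂μ ∂μ ∂volume := by
          refine lintegral_lintegral_swap (Measurable.aemeasurable ?_)
          apply Measurable.lintegral_prod_right' (f := fun p : (E × ℝ) × E =>
            V p.1.1 * W p.2 * g' (p.2 + p.1.2 • (p.1.1 - p.2)))
          fun_prop
      _ ≤ ∫⁻ _ in Ioo (0 : ℝ) 1, K * ∫⁻ x in D, w x * g x ∂μ ∂volume :=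
          setLIntegral_mono' measurableSet_Ioo hslice
      _ = K * ∫⁻ x in D, w x * g x ∂μ := by simp
  have hVU : ∫⁻ y, V y ∂μ = U := lintegral_indicator hD _
  have hne : μ.withDensity V ≠ 0 := by
    intro h
    apply hU0
    rw [← hVU, ← setLIntegral_univ, ← withDensity_apply _ MeasurableSet.univ, h]
    rfl
  have : IsFiniteMeasure (μ.withDensity V) := isFiniteMeasure_withDensity (by rw [hVU]; exact hU)
  -- Some `y` has `H y` at most the mean of `H` for the measure `u μ`; then `ξ = f y`.
  obtain ⟨y, hy⟩ := exists_le_laverage hne mH.aemeasurable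
  refine ⟨f y, ?_⟩
  have e1 : ∫⁻ x in D, w x * ENNReal.ofReal (|f x - f y| ^ 2) ∂μ = H y := by
    simp only [H, hW]
    rw [← lintegral_indicator hD]
    congr 1 with x
    by_cases hx : x ∈ D <;> simp [hx]
  rw [e1]
  refine hy.trans ?_
  rw [laverage_eq, withDensity_apply _ MeasurableSet.univ, setLIntegral_univ, hVU,
    lintegral_withDensity_eq_lintegral_mul _ mV mH, ENNReal.mul_div_right_comm.symm]
  gcongr
  exact hmain

open Set ENNReal in
theorem lintegral_comp_add_smul {E : Type*} [NormedAddCommGroup E] [NormedSpace ℝ E]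
    [FiniteDimensional ℝ E] [MeasurableSpace E] [BorelSpace E] (μ : Measure E)
    [μ.IsAddHaarMeasure] {F : E → ℝ≥0∞} (hF : Measurable F) (z : E) {s : ℝ} (hs : s ≠ 0) :
    ∫⁻ v, F (z + s • v) ∂μ =
      ENNReal.ofReal |(s ^ Module.finrank ℝ E)⁻¹| * ∫⁻ v, F v ∂μ := by
  have h1 : ∫⁻ v, F (z + s • v) ∂μ = ∫⁻ v, F (z + v) ∂(Measure.map (s • ·) μ) := by
    rw [lintegral_map (by fun_prop) (by fun_prop)]
  rw [h1, Measure.map_addHaar_smul μ hs, lintegral_smul_measure, lintegral_add_left_eq_self,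
    smul_eq_mul]

open Set ENNReal in
/-- Weighted Poincaré inequality on a convex set for a weight which, along segments, is controlled
at the endpoint by its values on the second half. -/
theorem exists_lintegral_sq_sub_le_of_doubling {E : Type*} [NormedAddCommGroup E]
    [NormedSpace ℝ E] [FiniteDimensional ℝ E] [MeasurableSpace E] [BorelSpace E] (μ : Measure E)
    [μ.IsAddHaarMeasure] {D : Set E} (hD : MeasurableSet D) (hconv : Convex ℝ D)
    {w g : E → ℝ≥0∞} (hw : Measurable w) (hg : Measurable g)
    {f : E → ℝ} (hf : Measurable f)
    (hfg : ∀ x ∈ D, ∀ y ∈ D,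
      ENNReal.ofReal (|f x - f y| ^ 2) ≤ ∫⁻ s in Ioo (0 : ℝ) 1, g (x + s • (y - x)))
    {c : ℝ≥0∞}
    (hc : ∀ x ∈ D, ∀ y ∈ D, ∀ s ∈ Icc (1 / 2 : ℝ) 1, w y ≤ c * w (x + s • (y - x)))
    (hU0 : ∫⁻ y in D, w y ∂μ ≠ 0) (hU : ∫⁻ y in D, w y ∂μ ≠ ∞) :
    ∃ ξ : ℝ, ∫⁻ x in D, w x * ENNReal.ofReal (|f x - ξ| ^ 2) ∂μ ≤
      c * 2 ^ Module.finrank ℝ E * ∫⁻ x in D, w x * g x ∂μ := by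
  have mW : Measurable (D.indicator w) := hw.indicator hD
  have hscale : ∀ (z : E) (s : ℝ), s ∈ Icc (1 / 2 : ℝ) 1 ∨ -s ∈ Icc (1 / 2 : ℝ) 1 →
      ∫⁻ v, D.indicator w (z + s • v) ∂μ ≤
        2 ^ Module.finrank ℝ E * ∫⁻ y in D, w y ∂μ := by
    intro z s hs
    have habs : 1 / 2 ≤ |s| := by
      rcases hs with hs | hs
      · exact hs.1.trans (le_abs_self _)
      · exact hs.1.trans (neg_le_abs _)
    have hs0 : s ≠ 0 := by
      rintro rfl
      norm_num at habs
    rw [lintegral_comp_add_smul μ mW z hs0, lintegral_indicator hD]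
    gcongr
    rw [abs_inv, abs_pow, ← inv_pow, ENNReal.ofReal_pow (by positivity)]
    gcongr
    rw [ENNReal.ofReal_le_iff_le_toReal (by simp)]
    rw [inv_le_comm₀ (by linarith) (by simp)]
    simpa using habs
  obtain ⟨ξ, hξ⟩ := exists_lintegral_sq_sub_le μ hD hconv hw hw hg hf hfg
    (K := c * 2 ^ Module.finrank ℝ E * ∫⁻ y in D, w y ∂μ) (by
      intro s hs
      refine Filter.Eventually.of_forall fun z hz => ?_
      -- The point `z` lies in the half of the segment nearer to `y` if `s ≥ 1/2`, nearer to `x`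
      -- otherwise. The weight at that nearer end is at most `c * w z`, and integrating the other
      -- factor costs a dilation of ratio at least `1/2`.
      rcases le_total (1 / 2) s with h | h
      · calc ∫⁻ v, D.indicator w (z - s • v) * D.indicator w (z + (1 - s) • v) ∂μ
            ≤ ∫⁻ v, (c * w z) * D.indicator w (z + (-s) • v) ∂μ := by
              apply lintegral_mono
              intro v
              simp only
              rw [mul_comm, neg_smul, ← sub_eq_add_neg]
              by_cases h1 : z - s • v ∈ D
              · gcongr
                by_cases h2 : z + (1 - s) • v ∈ D
                · rw [indicator_of_mem h2]
                  refine (hc _ h1 _ h2 s ⟨h, hs.2.le⟩).trans (le_of_eq ?_)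
                  congr 2
                  module
                · simp [h2]
              · simp [h1]
          _ = (c * w z) * ∫⁻ v, D.indicator w (z + (-s) • v) ∂μ :=
              lintegral_const_mul _ (by fun_prop)
          _ ≤ (c * w z) * (2 ^ Module.finrank ℝ E * ∫⁻ y in D, w y ∂μ) := by
              gcongr
              exact hscale z (-s) (Or.inr (by simpa using ⟨by simpa using h, hs.2.le⟩))
          _ = _ := by ring
      · calc ∫⁻ v, D.indicator w (z - s • v) * D.indicator w (z + (1 - s) • v) ∂μ
            ≤ ∫⁻ v, (c * w z) * D.indicator w (z + (1 - s) • v) ∂μ := by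
              apply lintegral_mono
              intro v
              simp only
              by_cases h1 : z + (1 - s) • v ∈ D
              · gcongr
                by_cases h2 : z - s • v ∈ D
                · rw [indicator_of_mem h2]
                  refine (hc _ h1 _ h2 (1 - s) ⟨by linarith, by linarith [hs.1]⟩).trans
                    (le_of_eq ?_)
                  congr 2
                  module
                · simp [h2]
              · simp [h1]
          _ = (c * w z) * ∫⁻ v, D.indicator w (z + (1 - s) • v) ∂μ :=
              lintegral_const_mul _ (by fun_prop)
          _ ≤ (c * w z) * (2 ^ Module.finrank ℝ E * ∫⁻ y in D, w y ∂μ) := by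
              gcongr
              exact hscale z (1 - s) (Or.inl ⟨by linarith, by linarith [hs.1]⟩)
          _ = _ := by ring) hU0 hU
  refine ⟨ξ, hξ.trans (le_of_eq ?_)⟩
  rw [ENNReal.mul_div_cancel_right hU0 hU]

/-! ### Growth of a C¹ function along Lipschitz paths -/

-- The path is only Lipschitz, as the boundary graphs are, so `f ∘ p` need not be differentiable.
-- Its right difference quotients are still bounded by `L * ‖G (p t)‖` up to `ε`, which suffices for
-- the mean value inequality.
open Set Filter in
theorem sub_le_integral_of_lipschitz_path {N : ℕ} {D : Set (Eucl N)}
    {f : Eucl N → ℝ} {G : Eucl N → Eucl N} (hG : ContinuousOn G D)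
    (hf : ∀ y ∈ D, HasGradientAt f (G y) y) {p : ℝ → Eucl N} {L : NNReal} (hp : LipschitzWith L p)
    (hpD : ∀ s ∈ Icc (0 : ℝ) 1, p s ∈ D) :
    f (p 1) - f (p 0) ≤ L * ∫ s in (0 : ℝ)..1, ‖G (p s)‖ := by
  -- Freezing the integrand outside `[0, 1]` makes it continuous on the line, hence its primitive
  -- differentiable everywhere.
  set b : ℝ → ℝ := fun s => ‖G (p (projIcc 0 1 zero_le_one s))‖ with hb
  have hbc : Continuous b := by
    rw [hb]
    refine Continuous.norm (hG.comp_continuous (hp.continuous.comp (by fun_prop)) ?_)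
    exact fun s => hpD _ (projIcc (0 : ℝ) 1 zero_le_one s).2
  have hbeq : ∀ s ∈ Icc (0 : ℝ) 1, b s = ‖G (p s)‖ := by
    intro s hs
    simp [hb, projIcc_of_mem zero_le_one hs]
  have hint : ∫ s in (0 : ℝ)..1, ‖G (p s)‖ = ∫ s in (0 : ℝ)..1, b s := by
    apply intervalIntegral.integral_congr
    intro s hs
    rw [uIcc_of_le zero_le_one] at hs
    exact (hbeq s hs).symm
  have key := image_le_of_liminf_slope_right_le_deriv_boundary (a := 0) (b := 1)
    (f := fun s => f (p s) - f (p 0)) (B := fun t => L * ∫ s in (0 : ℝ)..t, b s)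
    (B' := fun t => L * b t) ?_ (by simp) ?_ ?_ ?_ (right_mem_Icc.2 zero_le_one)
  · rw [hint]; exact key
  · intro s hs
    exact (((hf _ (hpD s hs)).hasFDerivAt.continuousAt.comp
      (hp.continuous.continuousAt)).sub continuousAt_const).continuousWithinAt
  · exact (continuous_const.mul
      (intervalIntegral.continuous_primitive (fun _ _ => hbc.intervalIntegrable _ _) _)).continuousOn
  · intro t _
    exact ((intervalIntegral.integral_hasDerivAt_right (hbc.intervalIntegrable _ _)
      (hbc.stronglyMeasurableAtFilter _ _) hbc.continuousAt).const_mul _).hasDerivWithinAt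
  · intro t ht r hr
    have htI : t ∈ Icc (0 : ℝ) 1 := ⟨ht.1, ht.2.le⟩
    rw [hbeq t htI] at hr
    apply Eventually.frequently
    obtain ⟨ε, hε, hεr⟩ : ∃ ε > 0, L * (‖G (p t)‖ + ε) < r := by
      have : Tendsto (fun ε : ℝ => L * (‖G (p t)‖ + ε)) (𝓝[>] 0) (𝓝 (L * (‖G (p t)‖ + 0))) := by
        refine Tendsto.mono_left (Continuous.tendsto ?_ _) nhdsWithin_le_nhds
        fun_prop
      rw [add_zero] at this
      obtain ⟨ε, h1, h2⟩ := ((this.eventually_lt_const hr).and self_mem_nhdsWithin).exists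
      exact ⟨ε, h2, h1⟩
    have h1 := ((hf _ (hpD t htI)).hasFDerivAt.isLittleO.def hε)
    have h2 := (hp.continuous.tendsto t).eventually h1
    filter_upwards [nhdsWithin_le_nhds h2, self_mem_nhdsWithin] with z hz htz
    have htz : t < z := htz
    rw [slope_def_field, div_lt_iff₀ (by linarith)]
    have h3 : ‖p z - p t‖ ≤ L * (z - t) := by
      have := hp.dist_le_mul z t
      rwa [dist_eq_norm, Real.dist_eq, abs_of_pos (by linarith)] at this
    have h4 : f (p z) - f (p t) ≤ (‖G (p t)‖ + ε) * ‖p z - p t‖ := by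
      have h5 := (abs_le.1 hz).2
      have h6 : (InnerProductSpace.toDual ℝ (Eucl N)) (G (p t)) (p z - p t) ≤
          ‖G (p t)‖ * ‖p z - p t‖ := by
        rw [InnerProductSpace.toDual_apply_apply]
        exact real_inner_le_norm _ _
      linarith
    have h7 : 0 ≤ ‖G (p t)‖ + ε := by positivity
    calc f (p z) - f (p 0) - (f (p t) - f (p 0)) = f (p z) - f (p t) := by ring
      _ ≤ (‖G (p t)‖ + ε) * (L * (z - t)) := h4.trans (by gcongr)
      _ = L * (‖G (p t)‖ + ε) * (z - t) := by ring
      _ < r * (z - t) := by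
        apply mul_lt_mul_of_pos_right hεr
        linarith

open Set Filter in
theorem ofReal_sq_sub_le_lintegral_of_lipschitz_path {N : ℕ} {D : Set (Eucl N)}
    {f : Eucl N → ℝ} {G : Eucl N → Eucl N} (hG : ContinuousOn G D)
    (hf : ∀ y ∈ D, HasGradientAt f (G y) y) {p : ℝ → Eucl N} {L : NNReal} (hp : LipschitzWith L p)
    (hpD : ∀ s ∈ Icc (0 : ℝ) 1, p s ∈ D) :
    ENNReal.ofReal (|f (p 0) - f (p 1)| ^ 2) ≤
      ∫⁻ s in Ioo (0 : ℝ) 1, ENNReal.ofReal (L ^ 2 * ‖gradient f (p s)‖ ^ 2) := by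
  have hcont : ContinuousOn (fun s => ‖G (p s)‖) (Icc 0 1) :=
    (hG.comp hp.continuous.continuousOn hpD).norm
  have habs : |f (p 0) - f (p 1)| ≤ L * ∫ s in (0 : ℝ)..1, ‖G (p s)‖ := by
    rw [abs_sub_comm, abs_le']
    refine ⟨sub_le_integral_of_lipschitz_path hG hf hp hpD, ?_⟩
    have := sub_le_integral_of_lipschitz_path (f := fun y => - f y) (G := fun y => - G y)
      hG.neg (fun y hy => by
        have := (hf y hy).hasFDerivAt.neg
        rw [hasGradientAt_iff_hasFDerivAt, map_neg]
        exact this) hp hpD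
    simp only [norm_neg] at this
    linarith
  have hci : IntervalIntegrable (fun s => ‖G (p s)‖) volume 0 1 :=
    ContinuousOn.intervalIntegrable (by rwa [uIcc_of_le zero_le_one])
  have hci2 : IntervalIntegrable (fun s => ‖G (p s)‖ ^ 2) volume 0 1 :=
    ContinuousOn.intervalIntegrable (by rw [uIcc_of_le zero_le_one]; exact hcont.pow 2)
  -- Cauchy–Schwarz on the unit interval, as nonnegativity of the variance.
  have hcs : (∫ s in (0 : ℝ)..1, ‖G (p s)‖) ^ 2 ≤ ∫ s in (0 : ℝ)..1, ‖G (p s)‖ ^ 2 := by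
    set m := ∫ s in (0 : ℝ)..1, ‖G (p s)‖ with hm
    have h0 : 0 ≤ ∫ s in (0 : ℝ)..1, (‖G (p s)‖ - m) ^ 2 :=
      intervalIntegral.integral_nonneg zero_le_one fun _ _ => sq_nonneg _
    have h1 : ∫ s in (0 : ℝ)..1, (‖G (p s)‖ - m) ^ 2 =
        (∫ s in (0 : ℝ)..1, ‖G (p s)‖ ^ 2) - 2 * m * m + m ^ 2 := by
      have : (fun s => (‖G (p s)‖ - m) ^ 2) =
          fun s => ‖G (p s)‖ ^ 2 - 2 * m * ‖G (p s)‖ + m ^ 2 := by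
        ext s; ring
      rw [this, intervalIntegral.integral_add (hci2.sub (hci.const_mul _)) (by simp),
        intervalIntegral.integral_sub hci2 (hci.const_mul _),
        intervalIntegral.integral_const_mul, ← hm]
      simp
    nlinarith
  have hsq : |f (p 0) - f (p 1)| ^ 2 ≤ ∫ s in (0 : ℝ)..1, L ^ 2 * ‖G (p s)‖ ^ 2 := by
    rw [intervalIntegral.integral_const_mul]
    calc |f (p 0) - f (p 1)| ^ 2 ≤ (L * ∫ s in (0 : ℝ)..1, ‖G (p s)‖) ^ 2 := by gcongr
      _ = L ^ 2 * (∫ s in (0 : ℝ)..1, ‖G (p s)‖) ^ 2 := by ring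
      _ ≤ _ := by gcongr
  refine (ENNReal.ofReal_le_ofReal hsq).trans ?_
  have hci3 : IntervalIntegrable (fun s => (L : ℝ) ^ 2 * ‖G (p s)‖ ^ 2) volume 0 1 :=
    hci2.const_mul _
  rw [intervalIntegrable_iff_integrableOn_Ioo_of_le zero_le_one] at hci3
  rw [intervalIntegral.integral_of_le zero_le_one, integral_Ioc_eq_integral_Ioo,
    ofReal_integral_eq_lintegral_ofReal hci3 (Eventually.of_forall fun s => by positivity)]
  apply le_of_eq
  apply setLIntegral_congr_fun measurableSet_Ioo
  intro s hs
  simp only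
  rw [(hf _ (hpD s (Ioo_subset_Icc_self hs))).gradient]

/-! ### The weight `|y|^lam` -/

-- In polar coordinates the integrand is `t^(N - 1 + lam)`, whose exponent exceeds `-1`.
open Set Metric in
theorem integrableOn_ball_norm_rpow {N : ℕ} (hN : 2 ≤ N) {lam : ℝ} (hlam : -(N : ℝ) < lam)
    (R : ℝ) : IntegrableOn (fun y : Eucl N => ‖y‖ ^ lam) (ball 0 R) := by
  have : Nonempty (Fin N) := ⟨⟨0, by omega⟩⟩
  have : Nontrivial (Eucl N) := inferInstance
  rcases le_or_gt R 0 with hR | hR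
  · simp [ball_eq_empty.2 hR]
  rw [integrableOn_fun_norm_addHaar volume (f := fun t : ℝ => t ^ lam)]
  have h := (intervalIntegral.integrableOn_Ioo_rpow_iff (s := (N : ℝ) - 1 + lam) hR).2
    (by linarith)
  refine h.congr_fun (fun y hy => ?_) measurableSet_Ioo
  simp only [finrank_euclideanSpace, Fintype.card_fin, smul_eq_mul]
  rw [Real.rpow_add hy.1, ← Real.rpow_natCast, Nat.cast_sub (by omega)]
  simp

open Set Metric ENNReal in
/-- The weight `|y|^lam` satisfies a Muckenhoupt `A₁` condition. -/
theorem exists_lintegral_ball_norm_rpow_le {N : ℕ} (hN : 2 ≤ N) {lam : ℝ}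
    (hlam : -(N : ℝ) < lam) (hlam' : lam ≤ 0) :
    ∃ C : ℝ≥0∞, C ≠ ∞ ∧ ∀ (z : Eucl N) (ρ s : ℝ), z ≠ 0 → 0 < ρ → 0 < s →
      ∫⁻ v in ball (0 : Eucl N) ρ, ENNReal.ofReal (‖z - s • v‖ ^ lam) ≤
        C * ENNReal.ofReal (ρ ^ N) * ENNReal.ofReal (‖z‖ ^ lam) := by
  set F : Eucl N → ℝ≥0∞ := (ball 0 1).indicator fun v => ENNReal.ofReal (‖v‖ ^ lam) with hF
  have mF : Measurable F := Measurable.indicator (by fun_prop) measurableSet_ball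
  have hFfin : ∫⁻ v, F v ≠ ∞ := by
    rw [hF, lintegral_indicator measurableSet_ball]
    exact (integrableOn_ball_norm_rpow hN hlam 1).lintegral_lt_top.ne
  refine ⟨ENNReal.ofReal ((1 / 2) ^ lam) * volume (ball (0 : Eucl N) 1) +
    ENNReal.ofReal (3 ^ N) * ∫⁻ v, F v, ?_, ?_⟩
  · exact ENNReal.add_ne_top.2 ⟨ENNReal.mul_ne_top ofReal_ne_top measure_ball_lt_top.ne,
      ENNReal.mul_ne_top ofReal_ne_top hFfin⟩
  intro z ρ s hz hρ hs
  have hz' : 0 < ‖z‖ := norm_pos_iff.2 hz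
  -- Either `z - s • v` stays at distance at least `‖z‖ / 2` from the origin, or `‖z‖ < 2 s ρ` and
  -- it stays in the ball of radius `R = 3 s ρ` about the origin. In the second case rescaling by
  -- `R` gives `R ^ lam * (3 ρ) ^ N` times a fixed integral, and `R ^ lam ≤ ‖z‖ ^ lam`; the powers
  -- of `s` cancel.
  rcases le_or_gt (s * ρ) (‖z‖ / 2) with h | h
  · calc ∫⁻ v in ball (0 : Eucl N) ρ, ENNReal.ofReal (‖z - s • v‖ ^ lam)
        ≤ ∫⁻ _ in ball (0 : Eucl N) ρ, ENNReal.ofReal ((1 / 2) ^ lam * ‖z‖ ^ lam) := by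
          apply setLIntegral_mono' measurableSet_ball
          intro v hv
          apply ENNReal.ofReal_le_ofReal
          rw [← Real.mul_rpow (by norm_num) hz'.le]
          apply Real.rpow_le_rpow_of_nonpos (by positivity) _ hlam'
          have h1 := norm_sub_norm_le z (s • v)
          have h2 : ‖s • v‖ ≤ s * ρ := by
            rw [norm_smul, Real.norm_of_nonneg hs.le]
            gcongr
            exact (mem_ball_zero_iff.1 hv).le
          linarith
      _ = (ENNReal.ofReal ((1 / 2) ^ lam) * volume (ball (0 : Eucl N) 1)) *
            ENNReal.ofReal (ρ ^ N) * ENNReal.ofReal (‖z‖ ^ lam) := by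
          rw [setLIntegral_const, Measure.addHaar_ball_of_pos _ _ hρ,
            ENNReal.ofReal_mul (by positivity)]
          simp only [finrank_euclideanSpace, Fintype.card_fin]
          ring
      _ ≤ _ := by
          gcongr
          exact le_self_add
  · set R := 3 * (s * ρ) with hR
    have hR0 : 0 < R := by positivity
    calc ∫⁻ v in ball (0 : Eucl N) ρ, ENNReal.ofReal (‖z - s • v‖ ^ lam)
        ≤ ∫⁻ v in ball (0 : Eucl N) ρ,
            ENNReal.ofReal (R ^ lam) * F (R⁻¹ • z + (-(R⁻¹ * s)) • v) := by
          apply setLIntegral_mono' measurableSet_ball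
          intro v hv
          have e : R⁻¹ • z + (-(R⁻¹ * s)) • v = R⁻¹ • (z - s • v) := by module
          have h2 : ‖s • v‖ ≤ s * ρ := by
            rw [norm_smul, Real.norm_of_nonneg hs.le]
            gcongr
            exact (mem_ball_zero_iff.1 hv).le
          have h1 := norm_sub_le z (s • v)
          have hmem : R⁻¹ • (z - s • v) ∈ ball (0 : Eucl N) 1 := by
            rw [mem_ball_zero_iff, norm_smul, norm_inv, Real.norm_of_nonneg hR0.le,
              inv_mul_lt_iff₀ hR0]
            linarith
          rw [e, hF, indicator_of_mem hmem, ← ENNReal.ofReal_mul (by positivity),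
            ← Real.mul_rpow hR0.le (norm_nonneg _), norm_smul, norm_inv,
            Real.norm_of_nonneg hR0.le, mul_inv_cancel_left₀ hR0.ne']
      _ ≤ ∫⁻ v, ENNReal.ofReal (R ^ lam) * F (R⁻¹ • z + (-(R⁻¹ * s)) • v) :=
          setLIntegral_le_lintegral _ _
      _ = ENNReal.ofReal (R ^ lam) * (ENNReal.ofReal ((3 * ρ) ^ N) * ∫⁻ v, F v) := by
          rw [lintegral_const_mul _ (by fun_prop),
            lintegral_comp_add_smul volume mF _ (by simpa using ⟨hR0.ne', hs.ne'⟩)]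
          congr 3
          have e2 : R⁻¹ * s = (3 * ρ)⁻¹ := by
            rw [hR]; field_simp
          rw [e2, abs_inv, abs_pow, abs_neg, abs_inv, abs_of_pos (by positivity), inv_pow, inv_inv]
          simp
      _ ≤ ENNReal.ofReal (‖z‖ ^ lam) * (ENNReal.ofReal ((3 * ρ) ^ N) * ∫⁻ v, F v) := by
          refine mul_le_mul_left (ENNReal.ofReal_le_ofReal ?_) _
          exact Real.rpow_le_rpow_of_nonpos hz' (by linarith) hlam'
      _ = (ENNReal.ofReal (3 ^ N) * ∫⁻ v, F v) * ENNReal.ofReal (ρ ^ N) *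
            ENNReal.ofReal (‖z‖ ^ lam) := by
          rw [mul_pow, ENNReal.ofReal_mul (by positivity)]
          ring
      _ ≤ _ := by
          gcongr
          exact le_add_self

/-! ### Bochner integrals and integrability of the weight -/

open Set Metric Filter in
/-- Passage from an inequality between lower Lebesgue integrals on an open set `D` of full measure
in `S` to Bochner integrals on `S`. -/
theorem iInf_integral_sq_sub_le {N : ℕ} {S D : Set (Eucl N)} (hSb : Bornology.IsBounded S)
    (hSm : MeasurableSet S) (hDo : IsOpen D) (hDS : D ⊆ S) (hnull : volume (S \ D) = 0)
    {W : Eucl N → ℝ} (hW0 : ∀ y, 0 ≤ W y) (hWi : IntegrableOn W S)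
    {f : Eucl N → ℝ} (hf : C1OnClosure S f) {C : ℝ} (hC : 0 ≤ C)
    (hineq : ∃ ξ : ℝ, ∫⁻ y in D, ENNReal.ofReal (W y) * ENNReal.ofReal (|f y - ξ| ^ 2) ≤
      ENNReal.ofReal C * ∫⁻ y in D, ENNReal.ofReal (W y) * ENNReal.ofReal (‖gradient f y‖ ^ 2)) :
    (∀ ξ : ℝ, IntegrableOn (fun y => W y * |f y - ξ| ^ 2) S) ∧
      IntegrableOn (fun y => W y * ‖gradient f y‖ ^ 2) S ∧
      (⨅ ξ : ℝ, ∫ y in S, W y * |f y - ξ| ^ 2) ≤ C * ∫ y in S, W y * ‖gradient f y‖ ^ 2 := by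
  obtain ⟨hfc, G, hGc, hG⟩ := hf
  have hcomp : IsCompact (closure S) := hSb.isCompact_closure
  have hDint : D ⊆ interior S := interior_maximal hDS hDo
  have hDS' : D =ᵐ[volume] S := by
    refine (hDS.eventuallyLE).antisymm ?_
    exact ae_le_set.2 hnull
  have h1 : ∀ ξ : ℝ, IntegrableOn (fun y => W y * |f y - ξ| ^ 2) S := by
    intro ξ
    have hc : ContinuousOn (fun y => |f y - ξ| ^ 2) (closure S) := by fun_prop
    obtain ⟨B, hB⟩ := hcomp.exists_bound_of_continuousOn hc
    refine hWi.mul_bdd (c := B) ((hc.mono subset_closure).aestronglyMeasurable hSm) ?_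
    exact (ae_restrict_iff' hSm).2 (Eventually.of_forall fun y hy => hB y (subset_closure hy))
  have h2 : IntegrableOn (fun y => W y * ‖gradient f y‖ ^ 2) S := by
    have hc : ContinuousOn (fun y => ‖G y‖ ^ 2) (closure S) := by fun_prop
    obtain ⟨B, hB⟩ := hcomp.exists_bound_of_continuousOn hc
    have : IntegrableOn (fun y => W y * ‖G y‖ ^ 2) S := by
      refine hWi.mul_bdd (c := B) ((hc.mono subset_closure).aestronglyMeasurable hSm) ?_
      exact (ae_restrict_iff' hSm).2 (Eventually.of_forall fun y hy => hB y (subset_closure hy))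
    refine IntegrableOn.congr_set_ae (t := D) ?_ hDS'.symm
    refine (this.mono_set hDS).congr_fun (fun y hy => ?_) hDo.measurableSet
    simp only
    rw [(hG y (hDint hy)).gradient]
  refine ⟨h1, h2, ?_⟩
  obtain ⟨ξ, hξ⟩ := hineq
  refine (ciInf_le ⟨0, ?_⟩ ξ).trans ?_
  · rintro _ ⟨ξ, rfl⟩
    exact integral_nonneg fun y => mul_nonneg (hW0 y) (by positivity)
  have n1 : ∀ y, 0 ≤ W y * |f y - ξ| ^ 2 := fun y => mul_nonneg (hW0 y) (by positivity)
  have n2 : ∀ y, 0 ≤ W y * ‖gradient f y‖ ^ 2 := fun y => mul_nonneg (hW0 y) (by positivity)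
  rw [← ENNReal.ofReal_le_ofReal_iff (mul_nonneg hC (integral_nonneg n2)),
    ENNReal.ofReal_mul hC,
    ofReal_integral_eq_lintegral_ofReal (h1 ξ) (Eventually.of_forall n1),
    ofReal_integral_eq_lintegral_ofReal h2 (Eventually.of_forall n2),
    ← setLIntegral_congr hDS', ← setLIntegral_congr hDS']
  simpa only [ENNReal.ofReal_mul (hW0 _)] using hξ

theorem poincareWeight_nonneg {N : ℕ} (Ω : Set (Eucl N)) (lam α : ℝ) (y : Eucl N) :
    0 ≤ poincareWeight Ω lam α y :=
  mul_nonneg (Real.rpow_nonneg (norm_nonneg _) _) (Real.rpow_nonneg Metric.infDist_nonneg _)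

theorem continuous_bdist {N : ℕ} (Ω : Set (Eucl N)) : Continuous (bdist Ω) :=
  Metric.continuous_infDist_pt _

theorem measurable_poincareWeight {N : ℕ} (Ω : Set (Eucl N)) (lam α : ℝ) :
    Measurable (poincareWeight Ω lam α) := by
  have := (continuous_bdist Ω).measurable
  unfold poincareWeight
  fun_prop

theorem measurable_gradient {N : ℕ} (f : Eucl N → ℝ) : Measurable (gradient f) := by
  unfold gradient
  exact (LinearIsometryEquiv.continuous _).measurable.comp (measurable_fderiv ℝ f)

open Set Metric Filter in
theorem integrableOn_poincareWeight {N : ℕ} (hN : 2 ≤ N) (Ω : Set (Eucl N)) {lam α : ℝ}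
    (hlam : -(N : ℝ) < lam) (hα : 0 < α) {S : Set (Eucl N)} (hS : Bornology.IsBounded S) :
    IntegrableOn (poincareWeight Ω lam α) S := by
  obtain ⟨R, hR⟩ := hS.subset_ball (0 : Eucl N)
  refine IntegrableOn.mono_set ?_ hR
  have hc : Continuous fun y => bdist Ω y ^ α :=
    (continuous_bdist Ω).rpow_const fun y => Or.inr hα.le
  obtain ⟨B, hB⟩ := (isCompact_closedBall (0 : Eucl N) R).exists_bound_of_continuousOn
    hc.continuousOn
  refine (integrableOn_ball_norm_rpow hN hlam R).mul_bdd (c := B) hc.aestronglyMeasurable ?_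
  exact (ae_restrict_iff' measurableSet_ball).2
    (Eventually.of_forall fun y hy => hB y (ball_subset_closedBall hy))

/-! ### Balls away from the boundary -/

-- Segments of `Q` become curves in `D`, with Lipschitz constant at most `Λ * ℓ`, so `D` itself need
-- not be convex. `P` is the identity for balls and `unflatten` for deformed cubes.
open Set in
theorem ofReal_sq_sub_le_lintegral_segment {N : ℕ} {E : Type*} [NormedAddCommGroup E]
    [NormedSpace ℝ E] {D : Set (Eucl N)} {f : Eucl N → ℝ} {G : Eucl N → Eucl N}
    (hG : ContinuousOn G D) (hf : ∀ y ∈ D, HasGradientAt f (G y) y) {P : E → Eucl N} {Λ : NNReal}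
    (hP : LipschitzWith Λ P) {Q : Set E} (hQ : Convex ℝ Q) (hPQ : MapsTo P Q D) {x y : E}
    (hx : x ∈ Q) (hy : y ∈ Q) {ℓ : ℝ} (hℓ : ‖y - x‖ ≤ ℓ) :
    ENNReal.ofReal (|f (P x) - f (P y)| ^ 2) ≤ ∫⁻ s in Ioo (0 : ℝ) 1,
      ENNReal.ofReal ((Λ * ℓ) ^ 2 * ‖gradient f (P (x + s • (y - x)))‖ ^ 2) := by
  have hseg : LipschitzWith ‖y - x‖₊ (fun s : ℝ => x + s • (y - x)) := by
    refine LipschitzWith.of_dist_le_mul fun s t => ?_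
    rw [dist_add_left, dist_eq_norm, ← sub_smul, norm_smul, mul_comm, Real.dist_eq, coe_nnnorm,
      Real.norm_eq_abs]
  have h := ofReal_sq_sub_le_lintegral_of_lipschitz_path hG hf (hP.comp hseg)
    (fun s hs => hPQ (hQ.add_smul_sub_mem hx hy hs))
  simp only [Function.comp_apply, zero_smul, add_zero, one_smul, add_sub_cancel] at h
  refine h.trans (lintegral_mono fun s => ENNReal.ofReal_le_ofReal ?_)
  push_cast
  gcongr

-- The ball misses the frontier and is connected, so it cannot leave `Ω`.
open Set Metric in
theorem ball_subset_of_le_bdist {N : ℕ} {Ω : Set (Eucl N)} (hΩ : IsOpen Ω) {x : Eucl N} {r : ℝ} (hx : x ∈ Ω)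
    (hr : 0 < r) (h : r ≤ bdist Ω x) : ball x r ⊆ Ω := by
  have hdisj : Disjoint (ball x r) (frontier Ω) :=
    (disjoint_ball_infDist (x := x)).mono_left (ball_subset_ball h)
  refine (convex_ball x r).isPreconnected.subset_left_of_subset_union hΩ
    isClosed_closure.isOpen_compl
    (disjoint_compl_right.mono_right (compl_subset_compl.2 subset_closure)) ?_
    ⟨x, mem_ball_self hr, hx⟩
  intro y hy
  have hyf := disjoint_left.1 hdisj hy
  rw [hΩ.frontier_eq] at hyf
  by_cases h1 : y ∈ Ω
  · exact Or.inl h1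
  · exact Or.inr fun h2 => hyf ⟨h2, h1⟩

theorem ContinuousOn.measurable_indicator {X : Type*} [TopologicalSpace X] [MeasurableSpace X]
    [BorelSpace X] {f : X → ℝ} {D : Set X} (hf : ContinuousOn f D) (hD : MeasurableSet D) :
    Measurable (D.indicator f) := by
  classical
  rw [← Set.piecewise_eq_indicator]
  exact hf.measurable_piecewise continuousOn_const hD

open Set Metric ENNReal in
theorem poincare_ball {N : ℕ} (hN : 2 ≤ N) (Ω : Set (Eucl N)) {γ α lam : ℝ}
    (hγ : 1 < γ) (hα : 0 < α) (hlam : -(N : ℝ) < lam) (hlam' : lam ≤ 0) :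
    ∃ C : ℝ, 0 < C ∧ ∀ x ∈ Ω, ∀ r : ℝ, 0 < r → γ * r ≤ bdist Ω x → ∀ f : Eucl N → ℝ,
      C1OnClosure (ball x r) f →
      ∃ ξ : ℝ, ∫⁻ y in ball x r,
          ENNReal.ofReal (poincareWeight Ω lam α y) * ENNReal.ofReal (|f y - ξ| ^ 2) ≤
        ENNReal.ofReal (C * r ^ 2) * ∫⁻ y in ball x r,
          ENNReal.ofReal (poincareWeight Ω lam α y) * ENNReal.ofReal (‖gradient f y‖ ^ 2) := by
  have : Nonempty (Fin N) := ⟨⟨0, by omega⟩⟩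
  obtain ⟨C, hC, hA⟩ := exists_lintegral_ball_norm_rpow_le hN hlam hlam'
  -- From `r ≤ d / γ`, the distance to the boundary on the ball is at least `d - d / γ = κ * d`.
  set κ : ℝ := 1 - 1 / γ with hκ
  have hκ0 : 0 < κ := by
    rw [hκ, sub_pos, div_lt_one (by linarith)]
    exact hγ
  set v₁ := volume (ball (0 : Eucl N) 1) with hv₁
  have hv0 : v₁ ≠ 0 := (measure_ball_pos volume _ one_pos).ne'
  have hvt : v₁ ≠ ∞ := measure_ball_lt_top.ne
  set C' : ℝ≥0∞ := ENNReal.ofReal ((2 / κ) ^ α) * C * ENNReal.ofReal (2 ^ N) / v₁ with hC'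
  have hC'fin : C' ≠ ∞ := by
    apply ENNReal.div_ne_top _ hv0
    exact ENNReal.mul_ne_top (ENNReal.mul_ne_top ofReal_ne_top hC) ofReal_ne_top
  -- The `4` is the square of the diameter `2 r` over `r ^ 2`; the `1` secures positivity.
  refine ⟨4 * C'.toReal + 1, by positivity, ?_⟩
  intro x hx r hr hd f hf
  obtain ⟨hfc, G, hGc, hG⟩ := hf
  rw [isOpen_ball.interior_eq] at hG
  set d := bdist Ω x with hdd
  have hd0 : 0 < d := lt_of_lt_of_le (by positivity) hd
  have hrd : r ≤ d / γ := by
    rw [le_div_iff₀ (by linarith)]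
    linarith
  have hrd' : r ≤ d := hrd.trans (div_le_self hd0.le hγ.le)
  have hlow : ∀ y ∈ ball x r, κ * d ≤ bdist Ω y := by
    intro y hy
    have h1 : d ≤ bdist Ω y + dist x y := infDist_le_infDist_add_dist
    have h2 : dist x y < r := by rw [dist_comm]; exact hy
    rw [hκ]
    have : (1 - 1 / γ) * d = d - d / γ := by ring
    linarith
  have hup : ∀ y ∈ ball x r, bdist Ω y ≤ 2 * d := by
    intro y hy
    have h1 : bdist Ω y ≤ d + dist y x := infDist_le_infDist_add_dist
    have h2 : dist y x < r := hy
    linarith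
  set w : Eucl N → ℝ≥0∞ := fun y => ENNReal.ofReal (poincareWeight Ω lam α y) with hw
  have mw : Measurable w := (measurable_poincareWeight Ω lam α).ennreal_ofReal
  have mg : Measurable fun y => ENNReal.ofReal (((1 : NNReal) * (2 * r)) ^ 2 *
      ‖gradient f y‖ ^ 2) := by
    have := measurable_gradient f
    fun_prop
  have mf : Measurable ((ball x r).indicator f) :=
    (hfc.mono subset_closure).measurable_indicator measurableSet_ball
  set K : ℝ≥0∞ := ENNReal.ofReal ((2 / κ) ^ α) * C * ENNReal.ofReal ((2 * r) ^ N) with hKdef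
  have hVol : ∫⁻ _ in ball x r, 1 = ENNReal.ofReal (r ^ N) * v₁ := by
    rw [setLIntegral_one, Measure.addHaar_ball_of_pos _ _ hr]
    simp [hv₁]
  have hrN : ENNReal.ofReal (r ^ N) ≠ 0 := by simpa using pow_pos hr N
  obtain ⟨ξ, hξ⟩ := exists_lintegral_sq_sub_le (volume : Measure (Eucl N)) measurableSet_ball
    (convex_ball x r) (w := w) (u := fun _ => 1) mw measurable_const mg mf (K := K)
    (by
      intro y hy z hz
      rw [indicator_of_mem hy, indicator_of_mem hz]
      refine ofReal_sq_sub_le_lintegral_segment (hGc.mono subset_closure) hG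
        (P := id) LipschitzWith.id (convex_ball x r) (mapsTo_id _) hy hz (ℓ := 2 * r) ?_
      rw [← dist_eq_norm]
      have h1 := dist_triangle_right z y x
      have h2 : dist z x < r := hz
      have h3 : dist y x < r := hy
      linarith)
    (by
      intro s hs
      -- The origin is discarded: for `lam < 0` the real power `0 ^ lam` is `0`, and the A₁ bound
      -- would fail there.
      have hz0 : ∀ᵐ z : Eucl N, z ≠ 0 := Measure.ae_ne volume 0
      filter_upwards [hz0] with z hz hzD
      calc ∫⁻ v, (ball x r).indicator w (z - s • v) *
            (ball x r).indicator (fun _ => 1) (z + (1 - s) • v)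
          ≤ ∫⁻ v, (ball (0 : Eucl N) (2 * r)).indicator
              (fun v => ENNReal.ofReal ((2 * d) ^ α) * ENNReal.ofReal (‖z - s • v‖ ^ lam)) v := by
            apply lintegral_mono
            intro v
            simp only
            by_cases h1 : z - s • v ∈ ball x r
            swap
            · simp [h1]
            by_cases h2 : z + (1 - s) • v ∈ ball x r
            swap
            · simp [h2]
            have hv : v ∈ ball (0 : Eucl N) (2 * r) := by
              have e : v = (z + (1 - s) • v) - (z - s • v) := by module
              rw [mem_ball_zero_iff, e, ← dist_eq_norm]
              have h3 := dist_triangle_right (z + (1 - s) • v) (z - s • v) x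
              have h4 : dist (z + (1 - s) • v) x < r := h2
              have h5 : dist (z - s • v) x < r := h1
              linarith
            rw [indicator_of_mem h1, indicator_of_mem h2, indicator_of_mem hv, mul_one,
              ← ENNReal.ofReal_mul (by positivity), mul_comm]
            apply ENNReal.ofReal_le_ofReal
            unfold poincareWeight
            gcongr
            · exact infDist_nonneg
            · exact hup _ h1
        _ = ENNReal.ofReal ((2 * d) ^ α) *
              ∫⁻ v in ball (0 : Eucl N) (2 * r), ENNReal.ofReal (‖z - s • v‖ ^ lam) := by
            rw [lintegral_indicator measurableSet_ball, lintegral_const_mul _ (by fun_prop)]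
        _ ≤ ENNReal.ofReal ((2 * d) ^ α) *
              (C * ENNReal.ofReal ((2 * r) ^ N) * ENNReal.ofReal (‖z‖ ^ lam)) := by
            gcongr
            exact hA z (2 * r) s hz (by positivity) hs.1
        _ = K * ENNReal.ofReal ((κ * d) ^ α * ‖z‖ ^ lam) := by
            have e : (2 * d) ^ α = (2 / κ) ^ α * (κ * d) ^ α := by
              rw [← Real.mul_rpow (by positivity) (by positivity)]
              congr 1
              field_simp
            rw [e, ENNReal.ofReal_mul (by positivity), ENNReal.ofReal_mul (by positivity), hKdef]
            ring
        _ ≤ K * w z := by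
            gcongr
            rw [hw, mul_comm]
            apply ENNReal.ofReal_le_ofReal
            unfold poincareWeight
            gcongr
            exact hlow z hzD)
    (by rw [hVol]; exact mul_ne_zero hrN hv0)
    (by rw [hVol]; exact ENNReal.mul_ne_top ofReal_ne_top hvt)
  refine ⟨ξ, ?_⟩
  have hKU : K / ∫⁻ _ in ball x r, 1 = C' := by
    rw [hVol, hKdef, hC', mul_pow, ENNReal.ofReal_mul (by positivity),
      mul_comm (ENNReal.ofReal (2 ^ N)), mul_comm _ (ENNReal.ofReal (r ^ N) * _), mul_assoc,
      ENNReal.mul_div_mul_left _ _ hrN ofReal_ne_top]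
    congr 1
    ring
  rw [hKU] at hξ
  calc _ = ∫⁻ y in ball x r, w y * ENNReal.ofReal (|(ball x r).indicator f y - ξ| ^ 2) := by
        refine setLIntegral_congr_fun measurableSet_ball fun y hy => ?_
        simp only [indicator_of_mem hy, hw]
    _ ≤ _ := hξ
    _ = C' * ENNReal.ofReal (4 * r ^ 2) *
          ∫⁻ y in ball x r, w y * ENNReal.ofReal (‖gradient f y‖ ^ 2) := by
        rw [mul_assoc, ← lintegral_const_mul (ENNReal.ofReal (4 * r ^ 2)) (by have := measurable_gradient f; fun_prop)]
        congr 1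
        refine lintegral_congr fun y => ?_
        rw [ENNReal.ofReal_mul (by positivity)]
        push_cast
        rw [show ((1 : ℝ) * (2 * r)) ^ 2 = 4 * r ^ 2 by ring]
        ring
    _ ≤ _ := by
        gcongr
        calc C' * ENNReal.ofReal (4 * r ^ 2)
            = ENNReal.ofReal C'.toReal * ENNReal.ofReal (4 * r ^ 2) := by
              rw [ENNReal.ofReal_toReal hC'fin]
          _ ≤ _ := by
              rw [← ENNReal.ofReal_mul (by positivity)]
              apply ENNReal.ofReal_le_ofReal
              nlinarith [sq_nonneg r]

/-! ### Cartesian charts and cubes -/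

/-- The vector with components `v` in the coordinate system `e`. -/
noncomputable def chartVec {N : ℕ} (e : CoordSystem N) : Eucl (N - 1) × ℝ →ₗ[ℝ] Eucl N :=
  (e.symm.linearIsometryEquiv.toLinearEquiv.toLinearMap).comp
    (WithLp.linearEquiv 2 ℝ (Eucl (N - 1) × ℝ)).symm.toLinearMap

/-- The point with coordinates `v` in the coordinate system `e`. -/
noncomputable def chartPoint {N : ℕ} (e : CoordSystem N) (v : Eucl (N - 1) × ℝ) : Eucl N :=
  e.symm (WithLp.toLp 2 v)

section chart

variable {N : ℕ} (e : CoordSystem N)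

theorem coord_chartPoint (v : Eucl (N - 1) × ℝ) : e (chartPoint e v) = WithLp.toLp 2 v :=
  e.apply_symm_apply _

theorem coord_chartPoint_fst (v : Eucl (N - 1) × ℝ) : (e (chartPoint e v)).fst = v.1 := by
  rw [coord_chartPoint]
  rfl

theorem coord_chartPoint_snd (v : Eucl (N - 1) × ℝ) : (e (chartPoint e v)).snd = v.2 := by
  rw [coord_chartPoint]
  rfl

theorem chartPoint_coord (y : Eucl N) : chartPoint e ((e y).fst, (e y).snd) = y :=
  e.symm_apply_apply y

theorem chartPoint_sub (v w : Eucl (N - 1) × ℝ) :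
    chartPoint e v - chartPoint e w = chartVec e (v - w) := by
  have := e.symm.map_vsub (WithLp.toLp 2 v) (WithLp.toLp 2 w)
  simp only [vsub_eq_sub] at this
  exact this.symm

theorem norm_chartVec (v : Eucl (N - 1) × ℝ) : ‖chartVec e v‖ = ‖WithLp.toLp 2 v‖ :=
  e.symm.linearIsometryEquiv.norm_map _

theorem norm_chartVec_le (v : Eucl (N - 1) × ℝ) : ‖chartVec e v‖ ≤ ‖v.1‖ + |v.2| := by
  rw [norm_chartVec, WithLp.prod_norm_eq_of_L2]
  apply Real.sqrt_le_iff.2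
  refine ⟨by positivity, ?_⟩
  change ‖v.1‖ ^ 2 + |v.2| ^ 2 ≤ _
  nlinarith [norm_nonneg v.1, abs_nonneg v.2]

theorem norm_chartVec_vertical (t : ℝ) : ‖chartVec e (0, t)‖ = |t| := by
  rw [norm_chartVec, WithLp.prod_norm_eq_of_L2]
  simp [Real.sqrt_sq_eq_abs]

theorem contDiff_coord : ContDiff ℝ 2 e := by
  have : (e : Eucl N → _) = fun y => e.linearIsometryEquiv y + e 0 := by
    ext1 y
    have := e.map_vadd 0 y
    simpa using this
  rw [this]
  exact e.linearIsometryEquiv.contDiff.add contDiff_const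

theorem contDiff_coord_fst : ContDiff ℝ 2 fun y => (e y).fst :=
  contDiff_fst.comp ((WithLp.prodContinuousLinearEquiv 2 ℝ (Eucl (N - 1)) ℝ).contDiff.comp
    (contDiff_coord e))

theorem contDiff_coord_snd : ContDiff ℝ 2 fun y => (e y).snd :=
  contDiff_snd.comp ((WithLp.prodContinuousLinearEquiv 2 ℝ (Eucl (N - 1)) ℝ).contDiff.comp
    (contDiff_coord e))

theorem continuous_chartPoint : Continuous (chartPoint e) :=
  e.symm.continuous.comp (WithLp.prodContinuousLinearEquiv 2 ℝ (Eucl (N - 1)) ℝ).symm.continuous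

end chart

theorem isCompact_cube {n : ℕ} (δ : ℝ) : IsCompact (cube δ : Set (Eucl n)) := by
  apply Metric.isCompact_of_isClosed_isBounded
  · have : (cube δ : Set (Eucl n)) = ⋂ j, {y | |y j| ≤ δ} := by
      ext y; simp [cube]
    rw [this]
    exact isClosed_iInter fun j => isClosed_le (by fun_prop) continuous_const
  · refine (Metric.isBounded_closedBall (x := (0 : Eucl n)) (r := √(∑ _ : Fin n, δ ^ 2))).subset ?_
    intro y hy
    rw [mem_closedBall_zero_iff, EuclideanSpace.norm_eq]
    apply Real.sqrt_le_sqrt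
    apply Finset.sum_le_sum
    intro j _
    rw [Real.norm_eq_abs]
    exact pow_le_pow_left₀ (abs_nonneg _) (hy j) 2

theorem convex_cube {n : ℕ} (δ : ℝ) : Convex ℝ (cube δ : Set (Eucl n)) := by
  have : (cube δ : Set (Eucl n)) = ⋂ j, (fun y : Eucl n => y j) ⁻¹' Set.Icc (-δ) δ := by
    ext y; simp [cube, abs_le]
  rw [this]
  refine convex_iInter fun j => ?_
  exact (convex_Icc (-δ) δ).is_linear_preimage
    ⟨fun x y => by simp, fun c x => by simp⟩

theorem zero_mem_cube {n : ℕ} {δ : ℝ} (hδ : 0 ≤ δ) : (0 : Eucl n) ∈ cube δ := fun j => by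
  simpa using hδ

/-- A linear functional vanishing on a cube vanishes. -/
theorem eq_zero_of_forall_mem_cube {n : ℕ} {δ : ℝ} (hδ : 0 < δ) (B : Eucl n →ₗ[ℝ] ℝ)
    (h : ∀ v ∈ cube δ, B v = 0) (v : Eucl n) : B v = 0 := by
  have h1 : (δ / (‖v‖ + 1)) • v ∈ cube (n := n) δ := by
    intro j
    have h2 : |v j| ≤ ‖v‖ := PiLp.norm_apply_le v j
    simp only [PiLp.smul_apply, smul_eq_mul, abs_mul]
    rw [abs_of_pos (by positivity), div_mul_eq_mul_div, div_le_iff₀ (by positivity)]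
    gcongr
    linarith
  have h3 := h _ h1
  rw [map_smul, smul_eq_mul] at h3
  exact (mul_eq_zero.1 h3).resolve_left (by positivity)

/-! ### Distance to the boundary and vertical distance -/

open Set Metric Filter in
/-- A strictly differentiable function is uniformly close to its linear part near the point. -/
theorem exists_ball_abs_sub_sub_le {N : ℕ} {ψ : Eucl N → ℝ} {A : Eucl N →L[ℝ] ℝ} {p : Eucl N}
    (h : HasStrictFDerivAt ψ A p) {ε : ℝ} (hε : 0 < ε) :
    ∃ ρ > 0, ∀ y ∈ ball p ρ, ∀ z ∈ ball p ρ, |ψ y - ψ z - A (y - z)| ≤ ε * ‖y - z‖ := by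
  have h1 := h.isLittleO.def hε
  obtain ⟨ρ, hρ, h2⟩ := Metric.eventually_nhds_iff_ball.1 h1
  refine ⟨ρ, hρ, fun y hy z hz => ?_⟩
  have h3 := h2 (y, z) (by
    rw [mem_ball, Prod.dist_eq]
    exact max_lt hy hz)
  simpa using h3

-- In the C² chart `ψ = y_N - φ(y')` has vertical derivative `1`. It vanishes on the frontier:
-- points with `ψ < 0` lie in the open set `Ω`, and points with `ψ > 0` have a neighbourhood missing
-- `Ω`.
open Set Metric Filter in
theorem exists_local_defining_function {N : ℕ} {Ω : Set (Eucl N)} (hΩ : IsC2BoundedDomain Ω)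
    {p : Eucl N} (hp : p ∈ frontier Ω) :
    ∃ (ψ : Eucl N → ℝ) (A : Eucl N →L[ℝ] ℝ), HasStrictFDerivAt ψ A p ∧ A ≠ 0 ∧
      ∀ᶠ y in 𝓝 p, (y ∈ Ω ↔ ψ y < 0) ∧ (y ∈ frontier Ω → ψ y = 0) := by
  obtain ⟨e, φ, hφ, he⟩ := hΩ.boundary_C2 p hp
  set ψ : Eucl N → ℝ := fun y => (e y).snd - φ (e y).fst with hψ
  have hψc : ContDiff ℝ 2 ψ := (contDiff_coord_snd e).sub (hφ.comp (contDiff_coord_fst e))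
  have hstr : HasStrictFDerivAt ψ (fderiv ℝ ψ p) p :=
    hψc.contDiffAt.hasStrictFDerivAt (by norm_num)
  refine ⟨ψ, fderiv ℝ ψ p, hstr, ?_, ?_⟩
  · intro h0
    have h1 : HasDerivAt (fun s : ℝ => ψ (p + s • chartVec e (0, 1))) 0 0 := by
      have h2 : HasDerivAt (fun s : ℝ => p + s • chartVec e (0, 1)) (chartVec e (0, 1)) 0 := by
        simpa using ((hasDerivAt_id (0 : ℝ)).smul_const (chartVec e (0, 1))).const_add p
      have h3 : HasFDerivAt ψ (fderiv ℝ ψ p) (p + (0 : ℝ) • chartVec e (0, 1)) := by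
        simpa using hstr.hasFDerivAt
      simpa [h0, Function.comp_def] using h3.comp_hasDerivAt (0 : ℝ) h2
    have h4 : (fun s : ℝ => ψ (p + s • chartVec e (0, 1))) = fun s => ψ p + s := by
      ext s
      have h5 : p + s • chartVec e (0, 1) = chartPoint e ((e p).fst, (e p).snd + s) := by
        have := chartPoint_sub e ((e p).fst, (e p).snd + s) ((e p).fst, (e p).snd)
        rw [chartPoint_coord, sub_eq_iff_eq_add'] at this
        rw [this, ← map_smul]
        simp
      rw [h5, hψ]
      simp only [coord_chartPoint_fst, coord_chartPoint_snd]
      ring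
    rw [h4] at h1
    have h6 := h1.unique ((hasDerivAt_id (0 : ℝ)).const_add (ψ p))
    norm_num at h6
  · filter_upwards [he.eventually_nhds] with y hy
    refine ⟨hy.self_of_nhds.trans (by rw [hψ, sub_neg]), fun hyf => ?_⟩
    rcases lt_trichotomy (ψ y) 0 with h | h | h
    · have : y ∈ Ω := hy.self_of_nhds.2 (by simpa [hψ] using h)
      exact absurd this (hΩ.isOpen.frontier_eq ▸ hyf).2
    · exact h
    · exfalso
      have h1 : ∀ᶠ z in 𝓝 y, 0 < ψ z := hψc.continuous.continuousAt.eventually_const_lt h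
      have h2 : ∀ᶠ z in 𝓝 y, z ∉ Ω := by
        filter_upwards [h1, hy] with z hz1 hz2 hzΩ
        have := hz2.1 hzΩ
        simp only [hψ] at hz1
        linarith
      exact (mem_closure_iff_frequently.1 hyf.1) h2

namespace LocalRep

variable {N : ℕ} {Ω : Set (Eucl N)} (R : LocalRep Ω)

theorem lipschitzOnWith (i : Fin R.m) :
    LipschitzOnWith R.A.toNNReal (R.a i) (cube R.δ) := by
  refine LipschitzOnWith.of_dist_le_mul fun y hy z hz => ?_
  rw [Real.dist_eq, dist_eq_norm, Real.coe_toNNReal _ R.A_pos.le]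
  exact R.lipschitz i y hy z hz

theorem chartPoint_mem_frontier (i : Fin R.m) {q : Eucl (N - 1)} (hq : q ∈ cube R.δ) :
    chartPoint (R.coord i) (q, R.a i q) ∈ frontier Ω := by
  have hβ := R.β_pos
  refine (R.inter_frontier i _ ?_ ?_ ?_).2 ?_ <;> simp only [coord_chartPoint_fst, coord_chartPoint_snd]
  · exact hq
  · linarith
  · linarith

open Set Metric Filter in
/-- At each point of the graph, the vertical derivative of a defining function is positive. -/
theorem fderiv_vertical_pos (i : Fin R.m) {q : Eucl (N - 1)} (hq : q ∈ cube R.δ)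
    {ψ : Eucl N → ℝ} {A : Eucl N →L[ℝ] ℝ}
    (hψ : HasStrictFDerivAt ψ A (chartPoint (R.coord i) (q, R.a i q))) (hA : A ≠ 0)
    (hΩψ : ∀ᶠ y in 𝓝 (chartPoint (R.coord i) (q, R.a i q)),
      (y ∈ Ω ↔ ψ y < 0) ∧ (y ∈ frontier Ω → ψ y = 0)) :
    0 < A (chartVec (R.coord i) (0, 1)) := by
  set e := R.coord i with he
  set p := chartPoint e (q, R.a i q) with hp
  obtain ⟨ρ₀, hρ₀, hloc⟩ := Metric.eventually_nhds_iff_ball.1 hΩψ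
  have hp0 : ψ p = 0 := (hloc p (mem_ball_self hρ₀)).2 (R.chartPoint_mem_frontier i hq)
  -- Points just below the graph lie in `Ω`, so `ψ` is negative there.
  have hnonneg : 0 ≤ A (chartVec e (0, 1)) := by
    refine le_of_forall_pos_le_add fun ε hε => ?_
    obtain ⟨ρ, hρ, hlin⟩ := exists_ball_abs_sub_sub_le hψ hε
    obtain ⟨s, hs0, hs⟩ := exists_between (lt_min (lt_min hρ hρ₀) R.β_pos)
    have hs1 := (hs.trans_le (min_le_left _ _)).trans_le (min_le_left _ _)
    have hs2 := (hs.trans_le (min_le_left _ _)).trans_le (min_le_right _ _)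
    have hs3 := hs.trans_le (min_le_right _ _)
    set y := chartPoint e (q, R.a i q - s) with hy
    have hyp : y - p = (-s) • chartVec e (0, 1) := by
      rw [hy, hp, chartPoint_sub, ← map_smul]
      simp
    have hdist : ‖y - p‖ = s := by
      rw [hyp, norm_smul, norm_chartVec_vertical]
      simp [abs_of_pos hs0]
    have hyΩ : y ∈ Ω := by
      refine (R.inter_domain i y ?_ ?_ ?_).2 ?_ <;> rw [← he, hy] <;> simp only [coord_chartPoint_fst, coord_chartPoint_snd]
      · exact hq
      all_goals linarith
    have h1 := ((hloc y (by rw [mem_ball, dist_eq_norm, hdist]; exact hs2)).1).1 hyΩ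
    have h2 := hlin y (by rw [mem_ball, dist_eq_norm, hdist]; exact hs1) p (mem_ball_self hρ)
    rw [hdist, hyp, map_smul, hp0, smul_eq_mul] at h2
    have h3 := (abs_le.1 h2).1
    have h4 : 0 ≤ s * (A (chartVec e (0, 1)) + ε) := by linarith
    exact (mul_nonneg_iff_of_pos_left hs0).1 h4
  refine lt_of_le_of_ne hnonneg fun h0 => hA ?_
  have hLip := R.A_pos
  -- If the vertical derivative vanished: `ψ` is zero at the graph point over `q + s • (q' - q)`,
  -- which is within `s * M` of `p` because the graph is Lipschitz, and its vertical displacement is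
  -- invisible to `A`. Letting `s` tend to `0` kills `A` in the direction `q' - q`.
  have hdir : ∀ q' ∈ cube (n := N - 1) R.δ, A (chartVec e (q' - q, 0)) = 0 := by
    intro q' hq'
    rw [← abs_nonpos_iff]
    refine le_of_forall_pos_le_add fun ε hε => ?_
    set M := (1 + R.A) * ‖q' - q‖ + 1 with hM
    have hM0 : 0 < M := by positivity
    obtain ⟨ρ, hρ, hlin⟩ := exists_ball_abs_sub_sub_le hψ (div_pos hε hM0)
    obtain ⟨s, hs0, hs⟩ := exists_between (lt_min (lt_min (div_pos hρ hM0) (div_pos hρ₀ hM0))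
      one_pos)
    have hs1 := (hs.trans_le (min_le_left _ _)).trans_le (min_le_left _ _)
    have hs2 := (hs.trans_le (min_le_left _ _)).trans_le (min_le_right _ _)
    have hs3 := hs.trans_le (min_le_right _ _)
    rw [lt_div_iff₀ hM0] at hs1 hs2
    have hqs : q + s • (q' - q) ∈ cube R.δ :=
      (convex_cube R.δ).add_smul_sub_mem hq hq' ⟨hs0.le, hs3.le⟩
    set y := chartPoint e (q + s • (q' - q), R.a i (q + s • (q' - q))) with hy
    set τ := R.a i (q + s • (q' - q)) - R.a i q with hτ
    have hyp : y - p = s • chartVec e (q' - q, 0) + τ • chartVec e (0, 1) := by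
      rw [hy, hp, chartPoint_sub, ← map_smul, ← map_smul, ← map_add]
      simp [hτ]
    have hτb : |τ| ≤ R.A * (s * ‖q' - q‖) := by
      have := R.lipschitz i _ hqs _ hq
      rwa [add_sub_cancel_left, norm_smul, Real.norm_of_nonneg hs0.le] at this
    have hdist : ‖y - p‖ ≤ s * M := by
      have h1 : y - p = chartVec e (s • (q' - q), τ) := by
        rw [hy, hp, chartPoint_sub]
        simp [hτ]
      rw [h1]
      refine (norm_chartVec_le e _).trans ?_
      simp only [norm_smul, Real.norm_of_nonneg hs0.le]
      rw [hM]
      nlinarith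
    have hyf : ψ y = 0 := (hloc y (by rw [mem_ball, dist_eq_norm]; linarith)).2
      (R.chartPoint_mem_frontier i hqs)
    have h2 := hlin y (by rw [mem_ball, dist_eq_norm]; linarith) p (mem_ball_self hρ)
    rw [hyp, hyf, hp0, map_add, map_smul, map_smul, ← h0, ← hyp] at h2
    have h3 : s * |A (chartVec e (q' - q, 0))| ≤ s * ε := by
      have h4 : |s * A (chartVec e (q' - q, 0))| ≤ ε / M * ‖y - p‖ := by
        simpa using h2
      rw [abs_mul, abs_of_pos hs0] at h4
      calc _ ≤ _ := h4
        _ ≤ ε / M * (s * M) := by gcongr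
        _ = s * ε := by field_simp
    rw [zero_add]
    exact le_of_mul_le_mul_left h3 hs0
  -- `B` is constant on the cube, which contains `0`; hence `B = 0`, even if `q` lies on an edge.
  let B : Eucl (N - 1) →ₗ[ℝ] ℝ := A.toLinearMap ∘ₗ chartVec e ∘ₗ LinearMap.inl ℝ _ _
  have hB : ∀ v, B v = 0 := by
    apply eq_zero_of_forall_mem_cube R.δ_pos
    have hB' : ∀ q' ∈ cube (n := N - 1) R.δ, B q' = B q := by
      intro q' hq'
      rw [← sub_eq_zero, ← map_sub]
      exact hdir q' hq'
    intro v hv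
    rw [hB' v hv, ← hB' 0 (zero_mem_cube R.δ_pos.le), map_zero]
  ext1 y
  have hy : y = chartVec e ((e y).fst - (e 0).fst, 0) +
      ((e y).snd - (e 0).snd) • chartVec e (0, 1) := by
    have := chartPoint_sub e ((e y).fst, (e y).snd) ((e 0).fst, (e 0).snd)
    rw [chartPoint_coord, chartPoint_coord, sub_zero] at this
    conv_lhs => rw [this]
    rw [← map_smul, ← map_add]
    simp
  rw [hy, map_add, map_smul, ← h0, smul_zero, add_zero]
  exact hB _

-- Two estimates of `-ψ y` are compared. Moving up to the graph gives `-ψ y ≥ (κ / 2) * t`; moving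
-- to a nearest boundary point `w`, over the cube or not, gives `-ψ y ≤ (‖A‖ + κ / 2) * bdist Ω y`.
open Set Metric Filter in
theorem exists_local_le_bdist (hΩ : IsC2BoundedDomain Ω) (i : Fin R.m) {q : Eucl (N - 1)}
    (hq : q ∈ cube R.δ) :
    ∃ ρ > 0, ∃ c > 0, ∀ y ∈ ball (chartPoint (R.coord i) (q, R.a i q)) ρ,
      (R.coord i y).fst ∈ cube R.δ → 0 ≤ R.a i (R.coord i y).fst - (R.coord i y).snd →
      R.a i (R.coord i y).fst - (R.coord i y).snd < ρ →
      c * (R.a i (R.coord i y).fst - (R.coord i y).snd) ≤ bdist Ω y := by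
  set e := R.coord i with he
  set p := chartPoint e (q, R.a i q) with hp
  have hpf : p ∈ frontier Ω := R.chartPoint_mem_frontier i hq
  obtain ⟨ψ, A, hψ, hA, hloc⟩ := exists_local_defining_function hΩ hpf
  have hκ := R.fderiv_vertical_pos i hq hψ hA hloc
  rw [← he] at hκ
  set κ := A (chartVec e (0, 1)) with hκdef
  obtain ⟨ρ₀, hρ₀, hloc⟩ := Metric.eventually_nhds_iff_ball.1 hloc
  obtain ⟨ρ₁, hρ₁, hlin⟩ := exists_ball_abs_sub_sub_le hψ (half_pos hκ)
  have hρ : 0 < min ρ₀ ρ₁ := lt_min hρ₀ hρ₁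
  -- Half the radius, so that `z` and `w` remain where `ψ` is controlled.
  refine ⟨min ρ₀ ρ₁ / 2, by positivity, κ / 2 / (‖A‖ + κ / 2), by positivity, ?_⟩
  intro y hy hyc ht0 ht
  set t := R.a i (e y).fst - (e y).snd with htdef
  have hsub : ball p (min ρ₀ ρ₁) ⊆ ball p ρ₁ := ball_subset_ball (min_le_right _ _)
  have hsub' : ball p (min ρ₀ ρ₁) ⊆ ball p ρ₀ := ball_subset_ball (min_le_left _ _)
  have hy' : y ∈ ball p (min ρ₀ ρ₁) := ball_subset_ball (by linarith) hy
  rw [mem_ball] at hy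
  set z := chartPoint e ((e y).fst, R.a i (e y).fst) with hz
  have hzy : z - y = t • chartVec e (0, 1) := by
    have := chartPoint_sub e ((e y).fst, R.a i (e y).fst) ((e y).fst, (e y).snd)
    rw [chartPoint_coord] at this
    rw [hz, this, ← map_smul]
    simp [htdef]
  have hzyn : ‖z - y‖ = t := by
    rw [hzy, norm_smul, norm_chartVec_vertical]
    simp [abs_of_nonneg ht0]
  have hzb : z ∈ ball p (min ρ₀ ρ₁) := by
    rw [mem_ball]
    have h1 := dist_triangle z y p
    rw [dist_eq_norm z y, hzyn] at h1
    linarith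
  have hψz : ψ z = 0 := (hloc z (hsub' hzb)).2 (R.chartPoint_mem_frontier i hyc)
  obtain ⟨w, hwf, hwd⟩ := isClosed_frontier.exists_infDist_eq_dist (s := frontier Ω) ⟨p, hpf⟩ y
  have hwd' : bdist Ω y = dist y w := hwd
  have hwb : w ∈ ball p (min ρ₀ ρ₁) := by
    have h1 : bdist Ω y ≤ dist y p := infDist_le_dist_of_mem hpf
    have h2 := dist_triangle_left w p y
    rw [mem_ball]
    linarith
  have hψw : ψ w = 0 := (hloc w (hsub' hwb)).2 hwf
  have h1 := (abs_le.1 (hlin z (hsub hzb) y (hsub hy'))).1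
  rw [hzyn, hzy, map_smul, hψz, smul_eq_mul, ← hκdef] at h1
  have h2 := (abs_le.1 (hlin w (hsub hwb) y (hsub hy'))).2
  have h3 : A (w - y) ≤ ‖A‖ * ‖w - y‖ := (le_abs_self _).trans (A.le_opNorm _)
  rw [hψw] at h2
  have h4 : ‖w - y‖ = bdist Ω y := by rw [hwd', dist_comm, dist_eq_norm]
  rw [h4] at h2 h3
  rw [div_mul_eq_mul_div, div_le_iff₀ (by positivity)]
  nlinarith

open Set Metric Filter in
/-- The distance to the boundary is bounded below by a multiple of the vertical distance. -/
theorem exists_le_bdist (hΩ : IsC2BoundedDomain Ω) (i : Fin R.m) :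
    ∃ ρ > 0, ∃ c > 0, ∀ y, (R.coord i y).fst ∈ cube R.δ →
      0 ≤ R.a i (R.coord i y).fst - (R.coord i y).snd →
      R.a i (R.coord i y).fst - (R.coord i y).snd < ρ →
      c * (R.a i (R.coord i y).fst - (R.coord i y).snd) ≤ bdist Ω y := by
  set e := R.coord i with he
  have hacont : ContinuousOn (R.a i) (cube R.δ) := (R.lipschitzOnWith i).continuousOn
  have hcomp : IsCompact ((fun q => chartPoint e (q, R.a i q)) '' cube R.δ) := by
    refine (isCompact_cube R.δ).image_of_continuousOn ?_
    exact (continuous_chartPoint e).comp_continuousOn (continuousOn_id.prodMk hacont)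
  -- The local constants become uniform by compactness of the graph over the closed cube.
  let Pr : Set (Eucl N) → Prop := fun K => ∃ ρ > 0, ∃ c > 0, ∀ p ∈ K, ∀ y ∈ ball p ρ,
    (e y).fst ∈ cube R.δ → 0 ≤ R.a i (e y).fst - (e y).snd →
      R.a i (e y).fst - (e y).snd < ρ → c * (R.a i (e y).fst - (e y).snd) ≤ bdist Ω y
  have key : Pr ((fun q => chartPoint e (q, R.a i q)) '' cube R.δ) := by
    refine hcomp.induction_on (p := Pr) ?_ ?_ ?_ ?_
    · exact ⟨1, one_pos, 1, one_pos, by simp⟩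
    · rintro s t hst ⟨ρ, hρ, c, hc, h⟩
      exact ⟨ρ, hρ, c, hc, fun p hp => h p (hst hp)⟩
    · rintro s t ⟨ρ, hρ, c, hc, h⟩ ⟨ρ', hρ', c', hc', h'⟩
      refine ⟨min ρ ρ', lt_min hρ hρ', min c c', lt_min hc hc', ?_⟩
      rintro p (hp | hp) y hy hyc h0 h1
      · exact (mul_le_mul_of_nonneg_right (min_le_left _ _) h0).trans
          (h p hp y (ball_subset_ball (min_le_left _ _) hy) hyc h0 (h1.trans_le (min_le_left _ _)))
      · exact (mul_le_mul_of_nonneg_right (min_le_right _ _) h0).trans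
          (h' p hp y (ball_subset_ball (min_le_right _ _) hy) hyc h0
            (h1.trans_le (min_le_right _ _)))
    · rintro _ ⟨q, hq, rfl⟩
      obtain ⟨ρ, hρ, c, hc, h⟩ := R.exists_local_le_bdist hΩ i hq
      refine ⟨_, mem_nhdsWithin_of_mem_nhds (ball_mem_nhds _ (half_pos hρ)), ρ / 2, half_pos hρ,
        c, hc, ?_⟩
      intro p hp y hy hyc h0 h1
      refine h y ?_ hyc h0 (by linarith)
      rw [mem_ball] at *
      have := dist_triangle y p (chartPoint (R.coord i) (q, R.a i q))
      linarith
  obtain ⟨ρ, hρ, c, hc, h⟩ := key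
  refine ⟨ρ, hρ, c, hc, fun y hyc h0 h1 => ?_⟩
  refine h _ ⟨(e y).fst, hyc, rfl⟩ y ?_ hyc h0 h1
  have := chartPoint_sub e ((e y).fst, (e y).snd) ((e y).fst, R.a i (e y).fst)
  rw [chartPoint_coord] at this
  rw [mem_ball, dist_eq_norm, this]
  simp only [Prod.mk_sub_mk, sub_self]
  rw [norm_chartVec_vertical, abs_sub_comm, abs_of_nonneg h0]
  exact h1

open Metric in
theorem bdist_le (i : Fin R.m) {y : Eucl N} (hy : (R.coord i y).fst ∈ cube R.δ) :
    bdist Ω y ≤ |R.a i (R.coord i y).fst - (R.coord i y).snd| := by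
  refine (infDist_le_dist_of_mem (R.chartPoint_mem_frontier i hy)).trans (le_of_eq ?_)
  have := chartPoint_sub (R.coord i) ((R.coord i y).fst, (R.coord i y).snd)
    ((R.coord i y).fst, R.a i (R.coord i y).fst)
  rw [chartPoint_coord] at this
  rw [dist_eq_norm, this]
  simp only [Prod.mk_sub_mk, sub_self]
  rw [norm_chartVec_vertical, abs_sub_comm]

end LocalRep

/-! ### Flattening a graph -/

section flatten

variable {N : ℕ} (e : CoordSystem N) (b : Eucl (N - 1) → ℝ)

/-- Coordinates `(y', b y' - y_N)` in which the graph of `b` is flat. -/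
noncomputable def flatten (y : Eucl N) : Eucl (N - 1) × ℝ :=
  ((e y).fst, b (e y).fst - (e y).snd)

/-- The inverse of `flatten`. -/
noncomputable def unflatten (v : Eucl (N - 1) × ℝ) : Eucl N :=
  chartPoint e (v.1, b v.1 - v.2)

theorem unflatten_flatten (y : Eucl N) : unflatten e b (flatten e b y) = y := by
  simp only [unflatten, flatten, sub_sub_cancel]
  exact chartPoint_coord e y

theorem flatten_unflatten (v : Eucl (N - 1) × ℝ) : flatten e b (unflatten e b v) = v := by
  simp only [unflatten, flatten, coord_chartPoint_fst, coord_chartPoint_snd, sub_sub_cancel]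

theorem continuous_flatten (hb : Continuous b) : Continuous (flatten e b) :=
  (contDiff_coord_fst e).continuous.prodMk
    ((hb.comp (contDiff_coord_fst e).continuous).sub (contDiff_coord_snd e).continuous)

theorem lipschitzWith_unflatten {A : NNReal} (hb : LipschitzWith A b) :
    LipschitzWith (A + 2) (unflatten e b) := by
  refine LipschitzWith.of_dist_le_mul fun v w => ?_
  rw [dist_eq_norm, unflatten, unflatten, chartPoint_sub]
  refine (norm_chartVec_le e _).trans ?_
  have h1 : ‖v.1 - w.1‖ ≤ dist v w := by
    rw [← dist_eq_norm, Prod.dist_eq]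
    exact le_max_left _ _
  have h2 : |v.2 - w.2| ≤ dist v w := by
    rw [← Real.dist_eq, Prod.dist_eq]
    exact le_max_right _ _
  have h3 : |b v.1 - b w.1| ≤ A * dist v w := by
    have := hb.dist_le_mul v.1 w.1
    rw [Real.dist_eq, dist_eq_norm] at this
    exact this.trans (by gcongr)
  have h4 : |b v.1 - v.2 - (b w.1 - w.2)| ≤ |b v.1 - b w.1| + |v.2 - w.2| := by
    rw [show b v.1 - v.2 - (b w.1 - w.2) = (b v.1 - b w.1) - (v.2 - w.2) by ring]
    exact abs_sub _ _
  push_cast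
  simp only [Prod.fst_sub, Prod.snd_sub]
  linarith

/-- A rigid motion followed, on each vertical line, by the reflection `t ↦ b y' - t`; no
differentiability of `b` is needed. -/
theorem measurePreserving_flatten (hb : Measurable b) :
    MeasurePreserving (flatten e b) volume volume := by
  have h1 : MeasurePreserving e volume volume := by
    have : (e : Eucl N → _) = fun y => e.linearIsometryEquiv y + e 0 := by
      ext1 y
      have := e.map_vadd 0 y
      simpa using this
    rw [this]
    exact (measurePreserving_add_right volume (e 0)).comp
      e.linearIsometryEquiv.measurePreserving
  have h2 : MeasurePreserving
      (fun v : Eucl (N - 1) × ℝ => (v.1, b v.1 - v.2)) volume volume :=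
    (MeasurePreserving.id volume).skew_product (g := fun x t => b x - t) (by fun_prop)
      (Filter.Eventually.of_forall fun x => (Measure.measurePreserving_sub_left volume (b x)).map_eq)
  exact h2.comp ((WithLp.volume_preserving_ofLp (Eucl (N - 1)) ℝ).comp h1)

theorem setLIntegral_preimage_flatten (hb : Measurable b) {Q : Set (Eucl (N - 1) × ℝ)}
    (hQ : MeasurableSet Q) {F : Eucl N → ENNReal}
    (hF : Measurable fun v => F (unflatten e b v)) :
    ∫⁻ y in flatten e b ⁻¹' Q, F y = ∫⁻ v in Q, F (unflatten e b v) := by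
  rw [← (measurePreserving_flatten e b hb).setLIntegral_comp_preimage hQ hF]
  simp only [unflatten_flatten]

end flatten

/-! ### Deformed cubes at the boundary -/

namespace LocalRep

variable {N : ℕ} {Ω : Set (Eucl N)} (R : LocalRep Ω)

-- With `t = a_i(y') - y_N` the cube is `d - r < t < d + r` and `Ω` is `t > 0`. The bound on `d + r`
-- keeps the points in the range where the chart describes `Ω`.
open Set Metric in
theorem deformedCube_inter_eq (i : Fin R.m) {b : Eucl (N - 1) → ℝ}
    (hb : EqOn (R.a i) b (cube R.δ)) {x : Eucl N} {r : ℝ} (hr : bdist Ω x + r < R.β) :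
    R.deformedCube i x r ∩ Ω = flatten (R.coord i) b ⁻¹'
      ((cube R.δ ∩ closedBall (R.coord i x).fst r) ×ˢ
        Ioo (max 0 (bdist Ω x - r)) (bdist Ω x + r)) := by
  have hβ := R.β_pos
  ext y
  simp only [deformedCube, flatten, mem_inter_iff, mem_ofPred_eq, mem_preimage, mem_prod,
    mem_closedBall, dist_eq_norm, mem_Ioo, max_lt_iff]
  constructor
  · rintro ⟨⟨h1, h2, h3, h4⟩, h5⟩
    rw [← hb h1]
    have h6 : (R.coord i y).snd < R.a i (R.coord i y).fst := by
      by_contra hcon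
      have h7 := (R.inter_domain i y h1 (by linarith) (by
        have : 0 ≤ bdist Ω x := infDist_nonneg
        linarith)).1 h5
      exact hcon h7
    exact ⟨⟨h1, h2⟩, ⟨by linarith, by linarith⟩, by linarith⟩
  · rintro ⟨⟨h1, h2⟩, ⟨h3, h4⟩, h5⟩
    rw [← hb h1] at h3 h4 h5
    exact ⟨⟨h1, h2, by linarith, by linarith⟩,
      (R.inter_domain i y h1 (by linarith) (by linarith)).2 (by linarith)⟩

open Set Metric in
/-- Near the boundary the weight is comparable to a power of the vertical distance. -/
theorem exists_poincareWeight_bounds (hΩ : IsC2BoundedDomain Ω) (h0 : (0 : Eucl N) ∈ Ω)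
    {α lam : ℝ} (hα : 0 < α) (hlam : lam ≤ 0) (i : Fin R.m) :
    ∃ ρ > 0, ∃ c₁ > 0, ∃ c₂ > 0, ∀ y ∈ Ω, (R.coord i y).fst ∈ cube R.δ →
      0 < R.a i (R.coord i y).fst - (R.coord i y).snd →
      R.a i (R.coord i y).fst - (R.coord i y).snd < ρ →
      c₁ * (R.a i (R.coord i y).fst - (R.coord i y).snd) ^ α ≤ poincareWeight Ω lam α y ∧
      poincareWeight Ω lam α y ≤ c₂ * (R.a i (R.coord i y).fst - (R.coord i y).snd) ^ α := by
  obtain ⟨ρ, hρ, c, hc, hlow⟩ := R.exists_le_bdist hΩ i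
  obtain ⟨ρ₀, hρ₀, hball⟩ := Metric.isOpen_iff.1 hΩ.isOpen 0 h0
  obtain ⟨M, hM0, hM⟩ : ∃ M > 0, Ω ⊆ ball (0 : Eucl N) M := hΩ.isBounded.subset_ball_lt 0 0
  -- The graph is at distance at least `ρ₀` from the origin, so `t < ρ₀ / 2` forces `ρ₀ / 2 ≤ ‖y‖ ≤
  -- M`.
  refine ⟨min ρ (ρ₀ / 2), by positivity, M ^ lam * c ^ α, by positivity, (ρ₀ / 2) ^ lam,
    by positivity, ?_⟩
  intro y hyΩ hyc ht0 ht
  set t := R.a i (R.coord i y).fst - (R.coord i y).snd with htdef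
  have ht1 := ht.trans_le (min_le_left _ _)
  have ht2 := ht.trans_le (min_le_right _ _)
  have hd1 := hlow y hyc ht0.le ht1
  have hd2 := R.bdist_le i hyc
  rw [← htdef] at hd1 hd2
  rw [abs_of_pos ht0] at hd2
  have hyM : ‖y‖ ≤ M := (mem_ball_zero_iff.1 (hM hyΩ)).le
  have hyρ : ρ₀ / 2 ≤ ‖y‖ := by
    have h1 := R.chartPoint_mem_frontier i hyc
    rw [hΩ.isOpen.frontier_eq] at h1
    have h2 : ρ₀ ≤ ‖chartPoint (R.coord i) ((R.coord i y).fst, R.a i (R.coord i y).fst)‖ := by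
      by_contra hcon
      exact h1.2 (hball (mem_ball_zero_iff.2 (not_le.1 hcon)))
    have h3 := chartPoint_sub (R.coord i) ((R.coord i y).fst, R.a i (R.coord i y).fst)
      ((R.coord i y).fst, (R.coord i y).snd)
    rw [chartPoint_coord] at h3
    have h4 := norm_sub_norm_le
      (chartPoint (R.coord i) ((R.coord i y).fst, R.a i (R.coord i y).fst)) y
    rw [h3] at h4
    simp only [Prod.mk_sub_mk, sub_self, norm_chartVec_vertical] at h4
    rw [← htdef, abs_of_pos ht0] at h4
    linarith
  have hy0 : 0 < ‖y‖ := by linarith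
  have hpow1 : M ^ lam ≤ ‖y‖ ^ lam := Real.rpow_le_rpow_of_nonpos hy0 hyM hlam
  have hpow2 : ‖y‖ ^ lam ≤ (ρ₀ / 2) ^ lam := Real.rpow_le_rpow_of_nonpos (by positivity) hyρ hlam
  unfold poincareWeight
  constructor
  · rw [mul_assoc, ← Real.mul_rpow hc.le ht0.le]
    gcongr
  · have : 0 ≤ bdist Ω y := infDist_nonneg
    gcongr

open Set Metric ENNReal in
theorem poincare_deformedCube (hN : 2 ≤ N) (hΩ : IsC2BoundedDomain Ω) (h0 : (0 : Eucl N) ∈ Ω)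
    {α lam : ℝ} (hα : 0 < α) (hlam : -(N : ℝ) < lam) (hlam' : lam ≤ 0) (i : Fin R.m) :
    ∃ C > 0, ∃ β > 0, ∀ (x : Eucl N) (r : ℝ), 0 < r → r < β → bdist Ω x < 2 * r →
      MeasurableSet (R.deformedCube i x r ∩ Ω) ∧
      ∃ D : Set (Eucl N), IsOpen D ∧ D ⊆ R.deformedCube i x r ∩ Ω ∧
        volume ((R.deformedCube i x r ∩ Ω) \ D) = 0 ∧
        ∀ f : Eucl N → ℝ, C1OnClosure (R.deformedCube i x r ∩ Ω) f →
          ∃ ξ : ℝ, ∫⁻ y in D, ENNReal.ofReal (poincareWeight Ω lam α y) *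
              ENNReal.ofReal (|f y - ξ| ^ 2) ≤
            ENNReal.ofReal (C * r ^ 2) * ∫⁻ y in D, ENNReal.ofReal (poincareWeight Ω lam α y) *
              ENNReal.ofReal (‖gradient f y‖ ^ 2) := by
  obtain ⟨ρ, hρ, c₁, hc₁, c₂, hc₂, hW⟩ := R.exists_poincareWeight_bounds hΩ h0 hα hlam' i
  obtain ⟨b, hbL, hab⟩ := (R.lipschitzOnWith i).extend_real
  have hA := R.A_pos
  have hβ := R.β_pos
  set n := Module.finrank ℝ (Eucl (N - 1) × ℝ) with hn
  set e := R.coord i with he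
  set P := unflatten e b with hP
  have hPL : LipschitzWith (R.A.toNNReal + 2) P := lipschitzWith_unflatten e b hbL
  have mP : Measurable P := hPL.continuous.measurable
  have mb : Measurable b := hbL.continuous.measurable
  set c : ℝ := c₂ * 2 ^ α / c₁ with hc
  -- `c * 2 ^ n` comes from the doubling inequality; `R.A + 2` is the Lipschitz constant of `P`, and
  -- `2 r` bounds the diameter of `Q`. Since `d < 2 r`, a third of the minimum ensures `d + r < min
  -- R.β ρ`.
  refine ⟨c * 2 ^ n * (2 * (R.A + 2)) ^ 2, by positivity, min R.β ρ / 3, by positivity, ?_⟩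
  intro x r hr hrβ hd
  have hd0 : 0 ≤ bdist Ω x := infDist_nonneg
  have hr1 : bdist Ω x + r < R.β := by linarith [min_le_left R.β ρ]
  have hr2 : bdist Ω x + r < ρ := by linarith [min_le_right R.β ρ]
  rw [R.deformedCube_inter_eq i hab hr1, ← he]
  set d := bdist Ω x with hdd
  set K : Set (Eucl (N - 1)) := cube R.δ ∩ closedBall (e x).fst r with hK
  set I : Set ℝ := Ioo (max 0 (d - r)) (d + r) with hI
  have hKc : Convex ℝ K := (convex_cube R.δ).inter (convex_closedBall _ _)
  have hKcl : IsClosed K := (isCompact_cube R.δ).isClosed.inter isClosed_closedBall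
  -- The interior makes the domain open, where `f` has a gradient; only the frontier of a convex
  -- set, which is null, is lost.
  set Q := interior K ×ˢ I with hQ
  have hQo : IsOpen Q := isOpen_interior.prod isOpen_Ioo
  have hQc : Convex ℝ Q := hKc.interior.prod (convex_Ioo _ _)
  have hsub : flatten e b ⁻¹' Q ⊆ flatten e b ⁻¹' (K ×ˢ I) :=
    preimage_mono (prod_mono_left interior_subset)
  have hDo : IsOpen (flatten e b ⁻¹' Q) := hQo.preimage (continuous_flatten e b hbL.continuous)
  have hmeas : MeasurableSet (K ×ˢ I) := hKcl.measurableSet.prod measurableSet_Ioo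
  refine ⟨(measurePreserving_flatten e b mb).measurable hmeas, flatten e b ⁻¹' Q, hDo, hsub, ?_,
    ?_⟩
  · rw [← preimage_sdiff, (measurePreserving_flatten e b mb).measure_preimage
      (hmeas.diff hQo.measurableSet).nullMeasurableSet]
    refine measure_mono_null (t := frontier K ×ˢ I) ?_ ?_
    · rintro v ⟨⟨h1, h2⟩, h3⟩
      refine ⟨?_, h2⟩
      rw [hKcl.frontier_eq]
      exact ⟨h1, fun h4 => h3 ⟨h4, h2⟩⟩
    · rw [Measure.volume_eq_prod, Measure.prod_prod, hKc.addHaar_frontier volume, zero_mul]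
  rintro f ⟨hfc, G, hGc, hG⟩
  set w : Eucl N → ℝ≥0∞ := fun y => ENNReal.ofReal (poincareWeight Ω lam α y) with hw
  have mw : Measurable w := (measurable_poincareWeight Ω lam α).ennreal_ofReal
  set D := flatten e b ⁻¹' Q with hD
  have hDS : D ⊆ closure (flatten e b ⁻¹' (K ×ˢ I)) := hsub.trans subset_closure
  set f' := D.indicator f with hf'
  have mf : Measurable f' := (hfc.mono hDS).measurable_indicator hDo.measurableSet
  have mgrad := measurable_gradient f
  have hPD : MapsTo P Q D := by
    intro v hv
    rw [hD, mem_preimage, hP, flatten_unflatten]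
    exact hv
  have hff' : ∀ ξ : ℝ, ∫⁻ y in D, w y * ENNReal.ofReal (|f y - ξ| ^ 2) =
      ∫⁻ v in Q, w (P v) * ENNReal.ofReal (|f' (P v) - ξ| ^ 2) := by
    intro ξ
    rw [← setLIntegral_preimage_flatten e b mb hQo.measurableSet
      (F := fun y => w y * ENNReal.ofReal (|f' y - ξ| ^ 2)) (by rw [← hP]; fun_prop)]
    refine setLIntegral_congr_fun hDo.measurableSet fun y hy => ?_
    simp only [hf', indicator_of_mem hy]
  have hgrad : ∫⁻ y in D, w y * ENNReal.ofReal (‖gradient f y‖ ^ 2) =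
      ∫⁻ v in Q, w (P v) * ENNReal.ofReal (‖gradient f (P v)‖ ^ 2) :=
    setLIntegral_preimage_flatten e b mb hQo.measurableSet (by rw [← hP]; fun_prop)
  have hU : ∫⁻ v in Q, w (P v) ≠ ∞ := by
    rw [← setLIntegral_preimage_flatten e b mb hQo.measurableSet (F := w)
      (by rw [← hP]; fun_prop)]
    have hDb : Bornology.IsBounded D := by
      refine hΩ.isBounded.subset (hsub.trans ?_)
      rw [he, hI, hK, hdd, he, ← R.deformedCube_inter_eq i hab hr1]
      exact inter_subset_right
    exact (integrableOn_poincareWeight hN Ω hlam hα hDb).lintegral_lt_top.ne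
  have hbound : ∀ v ∈ Q, 0 < v.2 ∧ c₁ * v.2 ^ α ≤ poincareWeight Ω lam α (P v) ∧
      poincareWeight Ω lam α (P v) ≤ c₂ * v.2 ^ α := by
    intro v hv
    have h1 : P v ∈ R.deformedCube i x r ∩ Ω := by
      rw [R.deformedCube_inter_eq i hab hr1]
      exact hsub (hPD hv)
    have hvc : v.1 ∈ cube R.δ := (interior_subset hv.1).1
    have h2 : (e (P v)).fst = v.1 := coord_chartPoint_fst e _
    have h3 : R.a i (e (P v)).fst - (e (P v)).snd = v.2 := by
      rw [h2, hab hvc, hP, unflatten, coord_chartPoint_snd]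
      exact sub_sub_cancel _ _
    have h4 : 0 < v.2 := (le_max_left _ _).trans_lt hv.2.1
    refine ⟨h4, ?_⟩
    have h5 := hW (P v) h1.2 h1.1.1 (by rw [h3]; exact h4)
      (by rw [h3]; exact hv.2.2.trans hr2)
    rwa [h3] at h5
  -- If the weight has no mass on `Q`, for instance if `Q` is empty, the left side vanishes.
  rcases eq_or_ne (∫⁻ v in Q, w (P v)) 0 with hU0 | hU0
  · refine ⟨0, ?_⟩
    rw [hff' 0]
    rw [lintegral_eq_zero_iff (by fun_prop)] at hU0
    refine le_trans (le_of_eq ?_) zero_le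
    rw [lintegral_eq_zero_iff (by fun_prop)]
    filter_upwards [hU0] with v hv
    simp only [Pi.zero_apply] at hv ⊢
    rw [hv, zero_mul]
  have hHaar : (volume : Measure (Eucl (N - 1) × ℝ)).IsAddHaarMeasure := by
    rw [Measure.volume_eq_prod]
    infer_instance
  obtain ⟨ξ, hξ⟩ := exists_lintegral_sq_sub_le_of_doubling
    (volume : Measure (Eucl (N - 1) × ℝ)) hQo.measurableSet hQc (w := fun v => w (P v))
    (g := fun v => ENNReal.ofReal (((R.A.toNNReal + 2 : NNReal) * (2 * r)) ^ 2 *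
      ‖gradient f (P v)‖ ^ 2)) (f := fun v => f' (P v)) (c := ENNReal.ofReal c)
    (by fun_prop) (by fun_prop) (by fun_prop)
    (by
      intro u hu v hv
      simp only [hf', indicator_of_mem (hPD hu), indicator_of_mem (hPD hv)]
      refine ofReal_sq_sub_le_lintegral_segment (hGc.mono hDS)
        (fun y hy => hG y (interior_maximal hsub hDo hy)) hPL hQc hPD hu hv ?_
      rw [Prod.norm_def]
      refine max_le ?_ ?_
      · have h1 := (interior_subset hu.1).2
        have h2 := (interior_subset hv.1).2
        rw [mem_closedBall] at h1 h2
        have h3 := dist_triangle_right v.1 u.1 (e x).fst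
        rw [Prod.fst_sub, ← dist_eq_norm]
        linarith
      · have h1 := hu.2
        have h2 := hv.2
        rw [hI, mem_Ioo, max_lt_iff] at h1 h2
        rw [Prod.snd_sub, Real.norm_eq_abs, abs_le]
        constructor <;> linarith)
    (by
      intro u hu v hv s hs
      have hz := hQc.add_smul_sub_mem hu hv (t := s) ⟨by linarith [hs.1], hs.2⟩
      obtain ⟨hu0, -⟩ := hbound u hu
      obtain ⟨hv0, -, hv2⟩ := hbound v hv
      obtain ⟨hz0, hz1, -⟩ := hbound _ hz
      simp only [hw]
      rw [← ENNReal.ofReal_mul (by positivity)]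
      apply ENNReal.ofReal_le_ofReal
      set z := u + s • (v - u) with hzdef
      -- `2 * z.2 - v.2 = 2 * (1 - s) * u.2 + (2 * s - 1) * v.2`, which is nonnegative for `1/2 ≤ s
      -- ≤ 1`.
      have hvz : v.2 ≤ 2 * z.2 := by
        have : z.2 = u.2 + s * (v.2 - u.2) := by simp [hzdef]
        rw [this]
        nlinarith [hs.1, hs.2]
      calc poincareWeight Ω lam α (P v) ≤ c₂ * v.2 ^ α := hv2
        _ ≤ c₂ * (2 * z.2) ^ α := by gcongr
        _ = c * (c₁ * z.2 ^ α) := by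
            rw [Real.mul_rpow (by norm_num) hz0.le, hc]
            field_simp
        _ ≤ _ := by gcongr) hU0 hU
  refine ⟨ξ, ?_⟩
  rw [hff', hgrad]
  refine hξ.trans (le_of_eq ?_)
  have e1 : ∀ v, w (P v) * ENNReal.ofReal (((R.A.toNNReal + 2 : NNReal) * (2 * r)) ^ 2 *
      ‖gradient f (P v)‖ ^ 2) = ENNReal.ofReal ((2 * (R.A + 2)) ^ 2 * r ^ 2) *
        (w (P v) * ENNReal.ofReal (‖gradient f (P v)‖ ^ 2)) := by
    intro v
    rw [ENNReal.ofReal_mul (by positivity)]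
    push_cast
    rw [Real.coe_toNNReal _ hA.le, show ((R.A + 2) * (2 * r)) ^ 2 =
      (2 * (R.A + 2)) ^ 2 * r ^ 2 by ring]
    ring
  simp only [e1]
  rw [lintegral_const_mul _ (by fun_prop), ← mul_assoc]
  congr 1
  rw [show (2 : ℝ≥0∞) ^ n = ENNReal.ofReal (2 ^ n) by
      rw [ENNReal.ofReal_pow (by norm_num)]; simp,
    ← ENNReal.ofReal_mul (by positivity), ← ENNReal.ofReal_mul (by positivity)]
  congr 1
  ring

end LocalRep

/-! ### Assembly of the two cases -/

theorem theorem2p4 (N : ℕ) (hN : 2 ≤ N) (Ω : Set (Eucl N)) (hΩ : IsC2BoundedDomain Ω)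
    (h0 : (0 : Eucl N) ∈ Ω) (R : LocalRep Ω) (γ : ℝ) (hγ : 1 < γ) (hγ' : γ < 2)
    (α : ℝ) (hα : 0 < α) (lam : ℝ) (hlam : -(N : ℝ) < lam) (hlam' : lam ≤ 0) :
    ∃ C_P β : ℝ, 0 < C_P ∧ 0 < β ∧ β ≤ R.β ∧
      ∀ x ∈ Ω, ∀ r : ℝ, 0 < r → r < β →
        ∀ S : Set (Eucl N), R.IsAdaptedBall γ x r S →
          ∀ f : Eucl N → ℝ, C1OnClosure (S ∩ Ω) f →
            (∀ ξ : ℝ, IntegrableOn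
              (fun y => poincareWeight Ω lam α y * |f y - ξ| ^ 2) (S ∩ Ω)) ∧
            IntegrableOn (fun y => poincareWeight Ω lam α y * ‖gradient f y‖ ^ 2) (S ∩ Ω) ∧
            (⨅ ξ : ℝ, ∫ y in S ∩ Ω, poincareWeight Ω lam α y * |f y - ξ| ^ 2) ≤
              C_P * r ^ 2 * (∫ y in S ∩ Ω, poincareWeight Ω lam α y * ‖gradient f y‖ ^ 2) := by
  obtain ⟨C₀, hC₀, hball⟩ := poincare_ball hN Ω hγ hα hlam hlam'
  choose C hC b hb hcube using fun i => R.poincare_deformedCube hN hΩ h0 hα hlam hlam' i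
  have hβ := R.β_pos
  have hCsum : 0 ≤ ∑ i, C i := Finset.sum_nonneg fun i _ => (hC i).le
  have hbsum : 0 ≤ ∑ i, (b i)⁻¹ := Finset.sum_nonneg fun i _ => (inv_pos.2 (hb i)).le
  -- Sums replace the maximum of the constants and, through inverses, the minimum of the radii; they
  -- make sense for any number of charts, including none.
  refine ⟨C₀ + ∑ i, C i, (R.β⁻¹ + ∑ i, (b i)⁻¹)⁻¹, by positivity, by positivity, ?_, ?_⟩
  · exact inv_le_of_inv_le₀ hβ (le_add_of_nonneg_right hbsum)
  intro x hx r hr hrβ S hS f hf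
  have hW0 := poincareWeight_nonneg Ω lam α
  have hbdd : Bornology.IsBounded (S ∩ Ω) := hΩ.isBounded.subset Set.inter_subset_right
  have hWi := integrableOn_poincareWeight hN Ω hlam hα hbdd
  have hnn : 0 ≤ ∫ y in S ∩ Ω, poincareWeight Ω lam α y * ‖gradient f y‖ ^ 2 :=
    integral_nonneg fun y => mul_nonneg (hW0 y) (by positivity)
  rcases hS with ⟨hd, rfl⟩ | ⟨hd, i, -, -, -, -, rfl⟩
  · have hsub : Metric.ball x r ⊆ Ω := ball_subset_of_le_bdist hΩ.isOpen hx hr (by nlinarith)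
    rw [Set.inter_eq_left.2 hsub] at *
    obtain ⟨h1, h2, h3⟩ := iInf_integral_sq_sub_le hbdd measurableSet_ball Metric.isOpen_ball
      subset_rfl (by simp) hW0 hWi hf (by positivity) (hball x hx r hr hd f hf)
    refine ⟨h1, h2, h3.trans ?_⟩
    gcongr
    linarith
  · have hri : r < b i := by
      refine hrβ.trans_le (inv_le_of_inv_le₀ (hb i) ?_)
      have := Finset.single_le_sum (f := fun i => (b i)⁻¹)
        (fun j _ => (inv_pos.2 (hb j)).le) (Finset.mem_univ i)
      have h2 : 0 < R.β⁻¹ := by positivity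
      linarith
    obtain ⟨hm, D, hDo, hDS, hnull, hP⟩ := hcube i x r hr hri (by nlinarith)
    have hCi := hC i
    obtain ⟨h1, h2, h3⟩ := iInf_integral_sq_sub_le hbdd hm hDo hDS hnull hW0 hWi hf
      (by positivity) (hP f hf)
    refine ⟨h1, h2, h3.trans ?_⟩
    have := Finset.single_le_sum (fun j _ => (hC j).le) (Finset.mem_univ i)
    gcongr
    linarith
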